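/- Let $P(x)=x^4-x^3-x^2-x-1$, let $\beta_2\in(-1,1)$ be the real root of $P$ of modulus less than $1$, let $\beta_3$ be the root of $P$ with positive imaginary part, and put $\alpha=(\beta_2,\beta_3)\in\mathbb R\times\mathbb C$. Operations on $\mathbb R\times\mathbb C$ are componentwise, so $\alpha^i=(\beta_2^i,\beta_3^i)$ for $i\in\mathbb Z$ and $1=\alpha^0=(1,1)$. Let $$\mathcal E=\Big\{\sum_{i\ge4}\varepsilon_i\alpha^i:\ \varepsilon_i\in\{0,1\},\ \varepsilon_i\varepsilon_{i+1}\varepsilon_{i+2}\varepsilon_{i+3}\neq1111\text{ for all }i\ge4\Big\},\qquad \mathcal E(u)=\mathcal E\cap(\mathcal E+u)\quad(u\in\mathbb R\times\mathbb C),$$ and let $X=\mathcal E(1+\alpha+\alpha^2)$, $Y=\mathcal E(1+\alpha)$. Let $$A=\{1,\ 1+\alpha,\ 1+\alpha^2,\ 1+\alpha+\alpha^2,\ \alpha^{-3}+\alpha^{-2}+1+\alpha^3,\ \alpha,\ \alpha+\alpha^2,\ \alpha^2,\ \alpha^{-2}+\alpha^{-1}+\alpha\}.$$ Then: a) $\mathcal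 E(1)=1+\alpha X$; b) $\mathcal E(\alpha^2)=-\frac1\alpha-1-\alpha+\frac X\alpha$; c) $\mathcal E(1+\alpha^2)=\big\{\frac{\alpha^4}{1-\alpha^2}\big\}$; d) $\mathcal E(\alpha^{-2}+\alpha^{-1}+\alpha)=\big\{\frac{\alpha^5+\alpha^6}{1-\alpha^4}\big\}$; e) $\mathcal E(\alpha^{-3}+\alpha^{-2}+1+\alpha^3)=\big\{\frac{\alpha^4+\alpha^5}{1-\alpha^4}\big\}$; f) $\mathcal E(\alpha)=f_0(X)\cup f_1(X)\cup f_1(Y)$, where $f_0(z)=\alpha+\alpha^2z$ and $f_1(z)=\alpha+\alpha^4+\alpha^2z$; g) $\mathcal E(\alpha+\alpha^2)=g_0(X)\cup g_1(X)\cup g_1(Y)\cup g_2(Y)\cup g_3(Y)$, where $g_0(z)=\alpha^5+\alpha^4z$, $g_1(z)=\alpha^5+\alpha^6+\alpha^4z$, $g_2(z)=\alpha z$, $g_3(z)=\alpha^4+\alpha z$; h) $X=\bigcup_{i=0}^{4}h_i(X)\cup h_1(Y)\cup h_3(Y)$; i) $Y=\bigcup_{i=5}^{11}h_i(Y)\cup\bigcup_{i=12}^{17}h_i(X)$,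 where $$\begin{array}{ll} h_0(z)=\alpha^4+\alpha^4z, & h_1(z)=\alpha^4+\alpha^6+\alpha^4z,\\ h_2(z)=\alpha^4+\alpha^5+\alpha^4z, & h_3(z)=\alpha^4+\alpha^5+\alpha^6+\alpha^4z,\\ h_4(z)=1+\alpha+\alpha^2+\alpha^7+\alpha^5z, & h_5=h_2,\\ h_6(z)=\alpha^4+\alpha^7+\alpha^4z, & h_7(z)=\alpha^4+\alpha^8+\alpha^9+\alpha^7z,\\ h_8=h_0, & h_9(z)=\alpha^4+\alpha^5+\alpha^7+\alpha^4z,\\ h_{10}(z)=\alpha^4+\alpha^5+\alpha^8+\alpha^9+\alpha^7z, & h_{11}(z)=1+\alpha+\alpha^6+\alpha^7+\alpha^5z,\\ h_{12}(z)=\alpha^4+\alpha^8+\alpha^7z, & h_{13}=h_7,\\ h_{14}(z)=\alpha^4+\alpha^5+\alpha^8+\alpha^7z, & h_{15}=h_{10},\\ h_{16}(z)=1+\alpha+\alpha^6+\alpha^5z, & h_{17}=h_{11}. \end{array}$$ Moreover $\mathcal E(-u)=\mathcal E(u)-u$ for every $u$. The set $A\cup(-A)$ has $18$ elements, $\mathcal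 E(u)$ is nonempty for each of them, and $\mathcal E(u)$ is a singleton for exactly six of them, namely $\pm(1+\alpha^2)$, $\pm(\alpha^{-2}+\alpha^{-1}+\alpha)$, $\pm(\alpha^{-3}+\alpha^{-2}+1+\alpha^3)$. The sets $X$ and $Y$ are compact, and the boundary of $\mathcal E$ is $\bigcup_{u\in A\cup(-A)}\mathcal E(u)$. Hence the boundary is a finite union of points and of affine images of $X$ and $Y$. -/

import Mathlib

open scoped Pointwise

noncomputable section

namespace Tetranacci

/-- The polynomial `x^4 - x^3 - x^2 - x - 1`. -/
def P : Polynomial ℤ :=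
  Polynomial.X ^ 4 - Polynomial.X ^ 3 - Polynomial.X ^ 2 - Polynomial.X - 1

/-- `β₂` is the real root of `P` of modulus less than one. -/
def IsRealRoot (β₂ : ℝ) : Prop := Polynomial.aeval β₂ P = 0 ∧ |β₂| < 1

/-- `β₃` is the complex root of `P` with positive imaginary part. -/
def IsComplexRoot (β₃ : ℂ) : Prop := Polynomial.aeval β₃ P = 0 ∧ 0 < β₃.im

/-- Sequences of digits `0, 1` with indices `i ≥ 4` (the digits of index `< 4` being `0`) in which
the block `1111` does not occur. -/
def Admissible (ε : ℕ → ℕ) : Prop :=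
  (∀ i, ε i = 0 ∨ ε i = 1) ∧ (∀ i < 4, ε i = 0) ∧
    ∀ i, ¬ (ε i = 1 ∧ ε (i + 1) = 1 ∧ ε (i + 2) = 1 ∧ ε (i + 3) = 1)

/-- The Rauzy fractal: the set of sums of `ε i * α ^ i`, for admissible `ε`. All operations on
`ℝ × ℂ` are componentwise. -/
def fractal (α : ℝ × ℂ) : Set (ℝ × ℂ) :=
  {z | ∃ ε : ℕ → ℕ, Admissible ε ∧ HasSum (fun i => (ε i : ℝ × ℂ) * α ^ i) z}

/-- The region `E(u) = E ∩ (E + u)`. -/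
def region (α u : ℝ × ℂ) : Set (ℝ × ℂ) :=
  fractal α ∩ (fun z => z + u) '' fractal α

/-- The nine elements `u` which, with their opposites, index the neighbour regions. -/
def halfShifts (α : ℝ × ℂ) : Set (ℝ × ℂ) :=
  {1, 1 + α, 1 + α ^ 2, 1 + α + α ^ 2,
    α ^ (-3 : ℤ) + α ^ (-2 : ℤ) + 1 + α ^ 3, α, α + α ^ 2, α ^ 2,
    α ^ (-2 : ℤ) + α ^ (-1 : ℤ) + α}

/-- The index set of the neighbour regions. -/
def shifts (α : ℝ × ℂ) : Set (ℝ × ℂ) := halfShifts α ∪ -halfShifts α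

/-- The three elements which, with their opposites, index the regions reduced to a point. -/
def halfPointShifts (α : ℝ × ℂ) : Set (ℝ × ℂ) :=
  {1 + α ^ 2, α ^ (-2 : ℤ) + α ^ (-1 : ℤ) + α, α ^ (-3 : ℤ) + α ^ (-2 : ℤ) + 1 + α ^ 3}

def pointShifts (α : ℝ × ℂ) : Set (ℝ × ℂ) := halfPointShifts α ∪ -halfPointShifts α

def X (α : ℝ × ℂ) : Set (ℝ × ℂ) := region α (1 + α + α ^ 2)

def Y (α : ℝ × ℂ) : Set (ℝ × ℂ) := region α (1 + α)

def f (α : ℝ × ℂ) : Fin 2 → ℝ × ℂ → ℝ × ℂ :=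
  ![fun z => α + α ^ 2 * z,
    fun z => α + α ^ 4 + α ^ 2 * z]

def g (α : ℝ × ℂ) : Fin 4 → ℝ × ℂ → ℝ × ℂ :=
  ![fun z => α ^ 5 + α ^ 4 * z,
    fun z => α ^ 5 + α ^ 6 + α ^ 4 * z,
    fun z => α * z,
    fun z => α ^ 4 + α * z]

def h (α : ℝ × ℂ) : Fin 18 → ℝ × ℂ → ℝ × ℂ :=
  ![fun z => α ^ 4 + α ^ 4 * z,
    fun z => α ^ 4 + α ^ 6 + α ^ 4 * z,
    fun z => α ^ 4 + α ^ 5 + α ^ 4 * z,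
    fun z => α ^ 4 + α ^ 5 + α ^ 6 + α ^ 4 * z,
    fun z => 1 + α + α ^ 2 + α ^ 7 + α ^ 5 * z,
    fun z => α ^ 4 + α ^ 5 + α ^ 4 * z,
    fun z => α ^ 4 + α ^ 7 + α ^ 4 * z,
    fun z => α ^ 4 + α ^ 8 + α ^ 9 + α ^ 7 * z,
    fun z => α ^ 4 + α ^ 4 * z,
    fun z => α ^ 4 + α ^ 5 + α ^ 7 + α ^ 4 * z,
    fun z => α ^ 4 + α ^ 5 + α ^ 8 + α ^ 9 + α ^ 7 * z,
    fun z => 1 + α + α ^ 6 + α ^ 7 + α ^ 5 * z,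
    fun z => α ^ 4 + α ^ 8 + α ^ 7 * z,
    fun z => α ^ 4 + α ^ 8 + α ^ 9 + α ^ 7 * z,
    fun z => α ^ 4 + α ^ 5 + α ^ 8 + α ^ 7 * z,
    fun z => α ^ 4 + α ^ 5 + α ^ 8 + α ^ 9 + α ^ 7 * z,
    fun z => 1 + α + α ^ 6 + α ^ 5 * z,
    fun z => 1 + α + α ^ 6 + α ^ 7 + α ^ 5 * z]

end Tetranacci

end

/-! ### Numerical location of the two roots -/

noncomputable section
namespace Tetranacci

/-! A point of `region α u` has two admissible expansions, one for the point itself and one for the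
point minus `u`. Reading one digit `p`, `q` of each and dividing by `α` replaces the difference `y`
by `α⁻¹ (y - p α ^ 4 + q α ^ 4)`, again in `ℤ[α]`. Remembering the lengths `r`, `s` of the current
runs of `1`, one gets a graph-directed system for the sets `pair α y r s` (`mem_pair_iff`). Two
points of tiles differ by a bounded amount, so a branch dies as soon as its difference is too large.
Starting from a nonzero element of the lattice spanned by `1, α, α ^ 2`, only the 28 differences of
`alive` remain, and 18 of them lie in the lattice: they index the neighbours.

All identities then become finite computations in `ℤ ^ 4`. A region is contained in a union of
affine pieces because its unfolding always ends in a piece (`cover_sound`); a piece is contained in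
a region because a path of digits leads to it (`carrier_subset`). Two points need care. A path may
reach `X` or `Y` after a run of `1`, which restricts the digits to come; `pair_vecX_subset` and
`pair_vecY_subset` show that this loses no point. Some branches end not in a piece but in one of six
regions which are single points, fixed by a contraction `z ↦ E + α ^ 4 z` (`eq_of_mem_points`); such
a point has another, eventually periodic, expansion which places it in a piece
(`mem_carrier_of_periodic`).

For the boundary, the lattice translates of the fractal form a locally finite covering of `ℝ × ℂ`
(`iUnion_cell`), by greedy expansions in Tetranacci numbers. A point of the fractal in no other
translate is therefore interior. Conversely, finite sums are dense in the fractal and lie in only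
one translate (`val_sub_ev_notMem`), so a point common to two translates is not interior. -/

/-- Numerical data on `α`: the equation of degree four, and the powers of `α` up to `10⁻³`. -/
structure RootBounds (α : ℝ × ℂ) : Prop where
  pow_four : α ^ 4 = α ^ 3 + α ^ 2 + α + 1
  norm_fst : |α.1| ≤ 0.775
  norm_snd : ‖α.2‖ ≤ 0.82
  fst_one : |1000 * α.1 - (-775)| ≤ 1
  fst_two : |1000 * (α.1 ^ 2) - 600| ≤ 1
  fst_three : |1000 * (α.1 ^ 3) - (-465)| ≤ 1
  re_one : |1000 * α.2.re - (-76)| ≤ 1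
  re_two : |1000 * (α.2 ^ 2).re - (-658)| ≤ 1
  re_three : |1000 * (α.2 ^ 3).re - 152| ≤ 1
  im_one : |1000 * α.2.im - 815| ≤ 1
  im_two : |1000 * (α.2 ^ 2).im - (-124)| ≤ 1
  im_three : |1000 * (α.2 ^ 3).im - (-526)| ≤ 1

lemma small_root_bounds {x : ℝ} (hx : x ^ 4 - x ^ 3 - x ^ 2 - x - 1 = 0) (h1 : |x| < 1) :
    -0.77481 < x ∧ x < -0.7748 := by
  obtain ⟨h2, h3⟩ := abs_lt.1 h1
  have h0 : x < 0 := by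
    by_contra! h0
    nlinarith [mul_nonneg h0 h0, pow_le_one₀ (n := 4) h0 h3.le, pow_nonneg h0 3,
      pow_pos (show (0 : ℝ) < 1 - x by linarith) 2]
  constructor
  · by_contra! h
    -- The bracket is the divided difference of `P` at `x` and the endpoint. It is negative for `-1
    -- < x < 0`, so `P` decreases there, and the sign of `P` at the endpoint gives a contradiction.
    have hq : 0 < -(x ^ 3 + x ^ 2 * (-0.77481) + x * (-0.77481) ^ 2 + (-0.77481) ^ 3
        - (x ^ 2 + x * (-0.77481) + (-0.77481) ^ 2) - (x + (-0.77481)) - 1) := by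
      nlinarith [mul_pos (neg_pos.2 h0) (neg_pos.2 h0), sq_nonneg (x + 1 / 2),
        mul_pos (mul_pos (neg_pos.2 h0) (neg_pos.2 h0)) (neg_pos.2 h0)]
    nlinarith [mul_nonneg hq.le (sub_nonneg.2 h)]
  · by_contra! h
    have hq : 0 < -(x ^ 3 + x ^ 2 * (-0.7748) + x * (-0.7748) ^ 2 + (-0.7748) ^ 3
        - (x ^ 2 + x * (-0.7748) + (-0.7748) ^ 2) - (x + (-0.7748)) - 1) := by
      nlinarith [mul_pos (neg_pos.2 h0) (neg_pos.2 h0), sq_nonneg (x + 1 / 2),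
        mul_pos (mul_pos (neg_pos.2 h0) (neg_pos.2 h0)) (neg_pos.2 h0)]
    nlinarith [mul_nonneg hq.le (sub_nonneg.2 h)]

lemma exists_large_root :
    ∃ x : ℝ, x ^ 4 - x ^ 3 - x ^ 2 - x - 1 = 0 ∧ 1.92756 < x ∧ x < 1.92757 := by
  have hc : ContinuousOn (fun x : ℝ => x ^ 4 - x ^ 3 - x ^ 2 - x - 1)
      (Set.Icc 1.92756 1.92757) := by fun_prop
  obtain ⟨x, ⟨hx1, hx2⟩, hx⟩ := intermediate_value_Ioo (by norm_num) hc
    (show (0 : ℝ) ∈ _ by constructor <;> norm_num)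
  exact ⟨x, hx, hx1, hx2⟩

lemma mul_mem_Icc_of_bounds {a b x c d y : ℝ} (ha : 0 ≤ a) (hc : 0 ≤ c) (h1 : a ≤ x) (h2 : x ≤ b)
    (h3 : c ≤ y) (h4 : y ≤ d) : a * c ≤ x * y ∧ x * y ≤ b * d :=
  ⟨mul_le_mul h1 h3 hc (ha.trans h1), mul_le_mul h2 h4 (hc.trans h3) ((ha.trans h1).trans h2)⟩

lemma complex_root_bounds {x : ℝ} {z : ℂ} (hx : x ^ 4 - x ^ 3 - x ^ 2 - x - 1 = 0)
    (hx1 : -0.77481 < x) (hx2 : x < -0.7748) (hz : z ^ 4 - z ^ 3 - z ^ 2 - z - 1 = 0)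
    (him : 0 < z.im) :
    -0.07639 < z.re ∧ z.re < -0.07637 ∧ 0.8146 < z.im ∧ z.im < 0.8148 := by
  obtain ⟨y, hy, hy1, hy2⟩ := exists_large_root
  have hxc : (x : ℂ) ^ 4 - (x : ℂ) ^ 3 - (x : ℂ) ^ 2 - x - 1 = 0 := by exact_mod_cast hx
  have hyc : (y : ℂ) ^ 4 - (y : ℂ) ^ 3 - (y : ℂ) ^ 2 - y - 1 = 0 := by exact_mod_cast hy
  have hzx : z - x ≠ 0 := fun h => by
    have := congrArg Complex.im h
    simp at this
    exact him.ne' this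
  have hzy : z - y ≠ 0 := fun h => by
    have := congrArg Complex.im h
    simp at this
    exact him.ne' this
  have hyx : (y : ℂ) - x ≠ 0 := fun h => by
    have := congrArg Complex.re h
    simp at this
    linarith
  -- Second divided difference of `P` at `z, x, y`: the quadratic factor left after removing the two
  -- real roots. Its real and imaginary parts express `z` through `x` and `y`.
  have key : z ^ 2 + (x + y - 1) * z + (x ^ 2 + x * y + y ^ 2 - x - y - 1) = 0 := by
    have : (z - x) * (z - y) * (y - x) *
        (z ^ 2 + (x + y - 1) * z + (x ^ 2 + x * y + y ^ 2 - x - y - 1)) = 0 := by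
      linear_combination (y - x) * hz - (z - x) * hyc + (z - y) * hxc
    simpa [hzx, hzy, hyx] using this
  have hre := congrArg Complex.re key
  have hi := congrArg Complex.im key
  simp [pow_two] at hre hi
  have hp : z.re = (1 - x - y) / 2 := by
    have : z.im * (2 * z.re + x + y - 1) = 0 := by linarith
    rcases mul_eq_zero.1 this with h | h
    · exact absurd h him.ne'
    · linarith
  have hq : z.im ^ 2 = (x ^ 2 + x * y + y ^ 2 - x - y - 1) - z.re ^ 2 := by
    rw [hp] at hre ⊢
    nlinarith
  have hxx := mul_mem_Icc_of_bounds (a := 0.7748) (b := 0.77481) (x := -x) (c := 0.7748)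
    (d := 0.77481) (y := -x) (by norm_num) (by norm_num) (by linarith) (by linarith) (by linarith)
    (by linarith)
  have hxy := mul_mem_Icc_of_bounds (a := 0.7748) (b := 0.77481) (x := -x) (c := 1.92756)
    (d := 1.92757) (y := y) (by norm_num) (by norm_num) (by linarith) (by linarith) (by linarith)
    (by linarith)
  have hyy := mul_mem_Icc_of_bounds (a := 1.92756) (b := 1.92757) (x := y) (c := 1.92756)
    (d := 1.92757) (y := y) (by norm_num) (by norm_num) (by linarith) (by linarith) (by linarith)
    (by linarith)
  have hpp := mul_mem_Icc_of_bounds (a := 0.07637) (b := 0.07639) (x := -z.re) (c := 0.07637)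
    (d := 0.07639) (y := -z.re) (by norm_num) (by norm_num) (by linarith) (by linarith)
    (by linarith) (by linarith)
  refine ⟨by linarith, by linarith, ?_, ?_⟩
  · by_contra! h
    nlinarith
  · by_contra! h
    nlinarith

lemma rootBounds {x : ℝ} {z : ℂ} (hx : IsRealRoot x) (hz : IsComplexRoot z) :
    RootBounds (x, z) := by
  obtain ⟨hx, hx1⟩ := hx
  obtain ⟨hz, him⟩ := hz
  simp only [P, map_sub, map_pow, Polynomial.aeval_X, map_one] at hx hz
  obtain ⟨h1, h2⟩ := small_root_bounds hx hx1
  obtain ⟨h3, h4, h5, h6⟩ := complex_root_bounds hx h1 h2 hz him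
  have hxx := mul_mem_Icc_of_bounds (a := 0.7748) (b := 0.77481) (x := -x) (c := 0.7748)
    (d := 0.77481) (y := -x) (by norm_num) (by norm_num) (by linarith) (by linarith) (by linarith)
    (by linarith)
  have hxxx := mul_mem_Icc_of_bounds (by norm_num) (by norm_num) hxx.1 hxx.2
    (show 0.7748 ≤ -x by linarith) (show -x ≤ 0.77481 by linarith)
  have hp1 : 0.07637 ≤ -z.re := by linarith
  have hp2 : -z.re ≤ 0.07639 := by linarith
  have hpp := mul_mem_Icc_of_bounds (by norm_num) (by norm_num) hp1 hp2 hp1 hp2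
  have hqq := mul_mem_Icc_of_bounds (by norm_num) (by norm_num) h5.le h6.le h5.le h6.le
  have hpq := mul_mem_Icc_of_bounds (by norm_num) (by norm_num) hp1 hp2 h5.le h6.le
  have hppp := mul_mem_Icc_of_bounds (by norm_num) (by norm_num) hpp.1 hpp.2 hp1 hp2
  have hpqq := mul_mem_Icc_of_bounds (by norm_num) (by norm_num) hpq.1 hpq.2 h5.le h6.le
  have hppq := mul_mem_Icc_of_bounds (by norm_num) (by norm_num) hpp.1 hpp.2 h5.le h6.le
  have hqqq := mul_mem_Icc_of_bounds (by norm_num) (by norm_num) hqq.1 hqq.2 h5.le h6.le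
  have re2 : (z ^ 2).re = z.re * z.re - z.im * z.im := by simp [pow_two]
  have im2 : (z ^ 2).im = 2 * (z.re * z.im) := by simp [pow_two]; ring
  have re3 : (z ^ 3).re = z.re * z.re * z.re - 3 * (z.re * z.im * z.im) := by
    simp [pow_succ]; ring
  have im3 : (z ^ 3).im = 3 * (z.re * z.re * z.im) - z.im * z.im * z.im := by
    simp [pow_succ]; ring
  norm_num only at hxx hxxx hpp hqq hpq hppp hpqq hppq hqqq
  have hx2 : x ^ 2 = -x * -x := by ring
  have hx3 : x ^ 3 = -(-x * -x * -x) := by ring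
  refine ⟨?_, ?_, ?_, ?_, ?_, ?_, ?_, ?_, ?_, ?_, ?_, ?_⟩
  · refine Prod.ext ?_ ?_
    · change x ^ 4 = x ^ 3 + x ^ 2 + x + 1
      linear_combination hx
    · change z ^ 4 = z ^ 3 + z ^ 2 + z + 1
      linear_combination hz
  · change |x| ≤ 0.775
    exact abs_le.2 ⟨by linarith only [h1, h2], by linarith only [h1, h2]⟩
  · change ‖z‖ ≤ 0.82
    refine abs_le_of_sq_le_sq' ?_ (by norm_num) |>.2
    rw [← Complex.normSq_eq_norm_sq, Complex.normSq_apply]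
    linarith only [neg_mul_neg z.re z.re, hpp.2, hqq.2]
  · change |1000 * x - (-775)| ≤ 1
    exact abs_le.2 ⟨by linarith only [h1, h2], by linarith only [h1, h2]⟩
  · change |1000 * x ^ 2 - 600| ≤ 1
    rw [hx2]
    exact abs_le.2 ⟨by linarith only [hxx.1, hxx.2], by linarith only [hxx.1, hxx.2]⟩
  · change |1000 * x ^ 3 - (-465)| ≤ 1
    rw [hx3]
    exact abs_le.2 ⟨by linarith only [hxxx.1, hxxx.2], by linarith only [hxxx.1, hxxx.2]⟩
  · change |1000 * z.re - (-76)| ≤ 1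
    exact abs_le.2 ⟨by linarith only [h3, h4], by linarith only [h3, h4]⟩
  · change |1000 * (z ^ 2).re - (-658)| ≤ 1
    rw [re2]
    exact abs_le.2 ⟨by linarith only [hpp.1, hpp.2, hqq.1, hqq.2],
      by linarith only [hpp.1, hpp.2, hqq.1, hqq.2]⟩
  · change |1000 * (z ^ 3).re - 152| ≤ 1
    rw [re3]
    exact abs_le.2 ⟨by linarith only [hppp.1, hppp.2, hpqq.1, hpqq.2],
      by linarith only [hppp.1, hppp.2, hpqq.1, hpqq.2]⟩
  · change |1000 * z.im - 815| ≤ 1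
    exact abs_le.2 ⟨by linarith only [h5, h6], by linarith only [h5, h6]⟩
  · change |1000 * (z ^ 2).im - (-124)| ≤ 1
    rw [im2]
    exact abs_le.2 ⟨by linarith only [hpq.1, hpq.2], by linarith only [hpq.1, hpq.2]⟩
  · change |1000 * (z ^ 3).im - (-526)| ≤ 1
    rw [im3]
    exact abs_le.2 ⟨by linarith only [hppq.1, hppq.2, hqqq.1, hqqq.2],
      by linarith only [hppq.1, hppq.2, hqqq.1, hqqq.2]⟩

end Tetranacci
end

/-! ### Arithmetic of `ℤ[α]` and the tiles as a graph-directed system -/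

noncomputable section
namespace Tetranacci

/-- Coordinates with respect to `1, α, α², α³`. -/
abbrev Vec := ℤ × ℤ × ℤ × ℤ

def ev (α : ℝ × ℂ) (x : Vec) : ℝ × ℂ :=
  (x.1 : ℝ × ℂ) + (x.2.1 : ℝ × ℂ) * α + (x.2.2.1 : ℝ × ℂ) * α ^ 2 + (x.2.2.2 : ℝ × ℂ) * α ^ 3

/-- Multiplication by `α` in coordinates. -/
def up (x : Vec) : Vec := (x.2.2.2, x.1 + x.2.2.2, x.2.1 + x.2.2.2, x.2.2.1 + x.2.2.2)

/-- Division by `α` in coordinates. -/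
def down (x : Vec) : Vec := (x.2.1 - x.1, x.2.2.1 - x.1, x.2.2.2 - x.1, x.1)

lemma ev_add (α : ℝ × ℂ) (x y : Vec) : ev α (x + y) = ev α x + ev α y := by
  simp only [ev, Prod.fst_add, Prod.snd_add, Int.cast_add]; ring

lemma ev_sub (α : ℝ × ℂ) (x y : Vec) : ev α (x - y) = ev α x - ev α y := by
  simp only [ev, Prod.fst_sub, Prod.snd_sub, Int.cast_sub]; ring

lemma ev_neg (α : ℝ × ℂ) (x : Vec) : ev α (-x) = -ev α x := by
  simp only [ev, Prod.fst_neg, Prod.snd_neg, Int.cast_neg]; ring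

@[simp] lemma ev_zero (α : ℝ × ℂ) : ev α 0 = 0 := by simp [ev]

section Root
variable {α : ℝ × ℂ}

lemma ev_up (hα : RootBounds α) (x : Vec) : ev α (up x) = α * ev α x := by
  simp only [ev, up, Int.cast_add]
  linear_combination (-(x.2.2.2 : ℝ × ℂ)) * hα.pow_four

lemma mul_ev_down (hα : RootBounds α) (x : Vec) : α * ev α (down x) = ev α x := by
  simp only [ev, down, Int.cast_sub]
  linear_combination (x.1 : ℝ × ℂ) * hα.pow_four

lemma ev_up_iterate (hα : RootBounds α) (n : ℕ) (x : Vec) :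
    ev α (up^[n] x) = α ^ n * ev α x := by
  induction n with
  | zero => simp
  | succ n ih => rw [Function.iterate_succ_apply', ev_up hα, ih]; ring

lemma mul_ev_down_iterate (hα : RootBounds α) (n : ℕ) (x : Vec) :
    α ^ n * ev α (down^[n] x) = ev α x := by
  induction n with
  | zero => simp
  | succ n ih => rw [Function.iterate_succ_apply', pow_succ, mul_assoc, mul_ev_down hα, ih]

/-- The coordinates of `α ^ 4` or `0`. -/
def lead (p : Bool) : Vec := if p then (1, 1, 1, 1) else 0

def digit (α : ℝ × ℂ) (p : Bool) : ℝ × ℂ := if p then α ^ 4 else 0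

lemma ev_lead (hα : RootBounds α) (p : Bool) : ev α (lead p) = digit α p := by
  cases p
  · simp [lead, digit]
  · simp [lead, digit, ev, hα.pow_four]; ring

/-- The coordinates of `α⁻¹ (y - p α ^ 4 + q α ^ 4)`. -/
def child (y : Vec) (p q : Bool) : Vec := down (y - lead p + lead q)

lemma mul_ev_child (hα : RootBounds α) (y : Vec) (p q : Bool) :
    α * ev α (child y p q) = ev α y - digit α p + digit α q := by
  rw [child, mul_ev_down hα, ev_add, ev_sub, ev_lead hα, ev_lead hα]

lemma norm_lt_one (hα : RootBounds α) : ‖α‖ < 1 := by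
  rw [Prod.norm_def]
  refine max_lt ?_ ?_
  · exact lt_of_le_of_lt hα.norm_fst (by norm_num)
  · exact lt_of_le_of_lt hα.norm_snd (by norm_num)

/-- `ℝ × ℂ` is not a field, but `α` is a unit since `P` has constant term `-1`. -/
lemma exists_inverse (hα : RootBounds α) : ∃ γ : ℝ × ℂ, α * γ = 1 :=
  ⟨α ^ 3 - α ^ 2 - α - 1, by linear_combination hα.pow_four⟩

lemma mul_left_cancel_pow (hα : RootBounds α) (n : ℕ) {z w : ℝ × ℂ}
    (h : α ^ n * z = α ^ n * w) : z = w := by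
  obtain ⟨γ, hγ⟩ := exists_inverse hα
  have h1 : γ ^ n * α ^ n = 1 := by rw [← mul_pow, mul_comm, hγ, one_pow]
  calc z = γ ^ n * α ^ n * z := by rw [h1, one_mul]
    _ = γ ^ n * (α ^ n * w) := by rw [mul_assoc, h]
    _ = w := by rw [← mul_assoc, h1, one_mul]

lemma exists_pow_mul_eq (hα : RootBounds α) (n : ℕ) (z : ℝ × ℂ) : ∃ w, α ^ n * w = z := by
  obtain ⟨γ, hγ⟩ := exists_inverse hα
  exact ⟨γ ^ n * z, by rw [← mul_assoc, ← mul_pow, hγ, one_pow, one_mul]⟩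

lemma exists_inverse_one_sub (hα : RootBounds α) {k : ℕ} (hk : k ≠ 0) :
    ∃ γ : ℝ × ℂ, (1 - α ^ k) * γ = 1 := by
  have h1 : ‖α ^ k‖ < 1 :=
    lt_of_le_of_lt (norm_pow_le' α (Nat.pos_of_ne_zero hk))
      (pow_lt_one₀ (norm_nonneg _) (norm_lt_one hα) hk)
  obtain ⟨u, hu⟩ := isUnit_one_sub_of_norm_lt_one h1
  exact ⟨u⁻¹.val, by rw [← hu]; simp⟩

lemma mul_left_cancel_one_sub (hα : RootBounds α) {k : ℕ} (hk : k ≠ 0) {z w : ℝ × ℂ}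
    (h : (1 - α ^ k) * z = (1 - α ^ k) * w) : z = w := by
  obtain ⟨γ, hγ⟩ := exists_inverse_one_sub hα hk
  linear_combination γ * h - (z - w) * hγ

end Root

/-- The sequence `δ`, preceded by `r` letters `1`, contains no block `1111`. -/
def NoFour (r : ℕ) (δ : ℕ → Bool) : Prop :=
  (∃ i < 4 - r, δ i = false) ∧ ∀ n, ∃ i < 4, δ (n + i) = false

def term (α : ℝ × ℂ) (δ : ℕ → Bool) (n : ℕ) : ℝ × ℂ := if δ n then α ^ (n + 4) else 0

def val (α : ℝ × ℂ) (δ : ℕ → Bool) : ℝ × ℂ := ∑' n, term α δ n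

/-- The sums of series whose digits avoid `1111`, even if preceded by `r` digits `1`. -/
def tile (α : ℝ × ℂ) (r : ℕ) : Set (ℝ × ℂ) := val α '' {δ | NoFour r δ}

/-- The length of the final run of `1`. -/
def next (p : Bool) (r : ℕ) : ℕ := if p then r + 1 else 0

/-- The condition is recognised by an automaton with states `r = 0, 1, 2, 3`. For `r ≥ 4` the
truncated difference `4 - r` is `0` and the first clause of `NoFour` fails, whence `r ≤ 3`. -/
lemma noFour_iff {r : ℕ} {δ : ℕ → Bool} :
    NoFour r δ ↔ r ≤ 3 ∧ NoFour (next (δ 0) r) (fun n => δ (n + 1)) := by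
  constructor
  · rintro ⟨⟨i, hi, hi'⟩, h⟩
    refine ⟨by omega, ?_, fun n => ?_⟩
    · cases h0 : δ 0
      · obtain ⟨j, hj, hj'⟩ := h 1
        exact ⟨j, by simpa [next] using hj, by rw [← hj', add_comm]⟩
      · rcases i with _ | i
        · rw [h0] at hi'; cases hi'
        · exact ⟨i, by simp only [next, if_true]; omega, hi'⟩
    · obtain ⟨j, hj, hj'⟩ := h (n + 1)
      exact ⟨j, hj, by rw [← hj', Nat.add_right_comm]⟩
  · rintro ⟨hr, ⟨i, hi, hi'⟩, h⟩
    have h1 : ∃ i < 4 - r, δ i = false := by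
      cases h0 : δ 0
      · exact ⟨0, by omega, h0⟩
      · rw [h0] at hi
        simp only [next, if_true] at hi
        exact ⟨i + 1, by omega, hi'⟩
    refine ⟨h1, fun n => ?_⟩
    rcases n with _ | n
    · obtain ⟨j, hj, hj'⟩ := h1
      exact ⟨j, by omega, by simpa using hj'⟩
    · obtain ⟨j, hj, hj'⟩ := h n
      exact ⟨j, hj, by rw [← hj', Nat.add_right_comm]⟩

lemma NoFour.anti {r s : ℕ} (h : r ≤ s) {δ : ℕ → Bool} (hδ : NoFour s δ) : NoFour r δ := by
  obtain ⟨⟨i, hi, hi'⟩, h2⟩ := hδ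
  exact ⟨⟨i, by omega, hi'⟩, h2⟩

lemma tile_anti (α : ℝ × ℂ) {r s : ℕ} (h : r ≤ s) : tile α s ⊆ tile α r :=
  Set.image_mono fun _ hδ => hδ.anti h

lemma zero_mem_tile (α : ℝ × ℂ) {r : ℕ} (hr : r ≤ 3) : (0 : ℝ × ℂ) ∈ tile α r :=
  ⟨fun _ => false, ⟨⟨0, by omega, rfl⟩, fun _ => ⟨0, by omega, rfl⟩⟩, by simp [val, term]⟩

section Tile
variable {α : ℝ × ℂ}

lemma norm_term_le (α : ℝ × ℂ) (δ : ℕ → Bool) (n : ℕ) : ‖term α δ n‖ ≤ ‖α‖ ^ 4 * ‖α‖ ^ n := by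
  unfold term
  split_ifs
  · rw [← pow_add, add_comm 4]
    exact norm_pow_le' α (by omega)
  · rw [norm_zero]; positivity

lemma summable_geom (hα : RootBounds α) : Summable fun n : ℕ => ‖α‖ ^ 4 * ‖α‖ ^ n :=
  (summable_geometric_of_lt_one (norm_nonneg _) (norm_lt_one hα)).mul_left _

lemma summable_term (hα : RootBounds α) (δ : ℕ → Bool) : Summable (term α δ) :=
  Summable.of_norm_bounded (summable_geom hα) (norm_term_le α δ)

lemma val_eq (hα : RootBounds α) (δ : ℕ → Bool) :
    val α δ = digit α (δ 0) + α * val α (fun n => δ (n + 1)) := by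
  rw [val, (summable_term hα δ).tsum_eq_zero_add, val, ← (summable_term hα _).tsum_mul_left]
  congr 1
  refine tsum_congr fun n => ?_
  simp only [term]
  split_ifs
  · ring
  · simp

lemma mem_tile_iff (hα : RootBounds α) {r : ℕ} {z : ℝ × ℂ} :
    z ∈ tile α r ↔ r ≤ 3 ∧ ∃ p, ∃ w ∈ tile α (next p r), z = digit α p + α * w := by
  constructor
  · rintro ⟨δ, hδ, rfl⟩
    obtain ⟨h1, h2⟩ := noFour_iff.1 hδ
    exact ⟨h1, δ 0, _, ⟨_, h2, rfl⟩, val_eq hα δ⟩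
  · rintro ⟨hr, p, _, ⟨δ, hδ, rfl⟩, rfl⟩
    refine ⟨fun n => Nat.rec (motive := fun _ => Bool) p (fun k _ => δ k) n,
      noFour_iff.2 ⟨hr, hδ⟩, val_eq hα _⟩

/-- Weierstrass test on the Cantor space `ℕ → Bool`; with `isClosed_noFour` it makes the tiles
compact. -/
lemma continuous_val (hα : RootBounds α) : Continuous (val α) := by
  refine continuous_tsum (fun n => ?_) (summable_geom hα) (fun n δ => norm_term_le α δ n)
  unfold term
  exact (continuous_of_discreteTopology
    (f := fun b : Bool => if b then α ^ (n + 4) else 0)).comp (continuous_apply n)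

lemma isClosed_noFour (r : ℕ) : IsClosed {δ : ℕ → Bool | NoFour r δ} := by
  have key : ∀ k n : ℕ, IsClosed {δ : ℕ → Bool | ∃ i < k, δ (n + i) = false} := by
    intro k n
    have : {δ : ℕ → Bool | ∃ i < k, δ (n + i) = false} =
        ⋃ i ∈ Set.Iio k, {δ : ℕ → Bool | δ (n + i) = false} := by ext; simp
    rw [this]
    exact (Set.finite_Iio k).isClosed_biUnion fun i _ =>
      isClosed_eq (continuous_apply _) continuous_const
  have : {δ : ℕ → Bool | NoFour r δ} = {δ : ℕ → Bool | ∃ i < 4 - r, δ (0 + i) = false} ∩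
      ⋂ n, {δ : ℕ → Bool | ∃ i < 4, δ (n + i) = false} := by
    ext; simp [NoFour]
  rw [this]
  exact (key _ _).inter (isClosed_iInter fun n => key _ _)

lemma isCompact_tile (hα : RootBounds α) (r : ℕ) : IsCompact (tile α r) :=
  (isClosed_noFour r).isCompact.image (continuous_val hα)

lemma fractal_eq_tile (hα : RootBounds α) : fractal α = tile α 0 := by
  ext z
  constructor
  · rintro ⟨ε, ⟨h1, h2, h3⟩, hs⟩
    refine ⟨fun n => decide (ε (n + 4) = 1), ⟨?_, fun n => ?_⟩, ?_⟩
    · by_contra! h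
      have h' : ∀ i < 4, ε (i + 4) = 1 := fun i hi => by simpa using h i hi
      exact h3 4 ⟨h' 0 (by omega), h' 1 (by omega), h' 2 (by omega), h' 3 (by omega)⟩
    · by_contra! h
      have h' : ∀ i < 4, ε (n + 4 + i) = 1 := fun i hi => by
        rw [Nat.add_right_comm]; simpa using h i hi
      exact h3 (n + 4) ⟨h' 0 (by omega), h' 1 (by omega), h' 2 (by omega), h' 3 (by omega)⟩
    · have h4 := (hasSum_nat_add_iff' 4).2 hs
      rw [Finset.sum_eq_zero (fun i hi => by rw [h2 i (Finset.mem_range.1 hi)]; simp), sub_zero]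
        at h4
      rw [← h4.tsum_eq]
      refine tsum_congr fun n => ?_
      rcases h1 (n + 4) with h | h <;> simp [term, h]
  · rintro ⟨δ, ⟨-, h⟩, rfl⟩
    refine ⟨fun n => if n < 4 then 0 else (δ (n - 4)).toNat, ⟨fun i => ?_, fun i hi => ?_,
      fun i => ?_⟩, ?_⟩
    · dsimp only
      split_ifs
      · exact Or.inl rfl
      · cases δ (i - 4) <;> simp
    · simp [hi]
    · rintro ⟨e1, e2, e3, e4⟩
      by_cases hi : i < 4
      · simp [hi] at e1
      · obtain ⟨j, hj, hj'⟩ := h (i - 4)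
        have : ∀ j < 4, (if i + j < 4 then 0 else (δ (i + j - 4)).toNat) = 1 := by
          intro j hj
          interval_cases j
          exacts [e1, e2, e3, e4]
        have h5 := this j hj
        rw [if_neg (by omega), show i + j - 4 = i - 4 + j by omega, hj'] at h5
        simp at h5
    · rw [← hasSum_nat_add_iff' 4, Finset.sum_eq_zero (fun i hi => by
        simp [Finset.mem_range.1 hi]), sub_zero]
      refine (summable_term hα δ).hasSum.congr_fun ?_
      intro n
      cases hn : δ n <;> simp [term, hn]

lemma hasSum_geom_four {r : ℝ} (h0 : 0 ≤ r) (h1 : r < 1) :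
    HasSum (fun n : ℕ => r ^ (n + 4)) (r ^ 4 * (1 - r)⁻¹) := by
  simpa only [pow_add, mul_comm] using (hasSum_geometric_of_lt_one h0 h1).mul_left (r ^ 4)

/-- Digits differ by `-1`, `0` or `1`, so a single geometric series bounds the difference: `0.775 ^
4 / (1 - 0.775) < 1.61`. The complex component below uses `0.82 ^ 4 / (1 - 0.82) < 2.52`. -/
lemma fst_sub_le (hα : RootBounds α) {r s : ℕ} {z w : ℝ × ℂ} (hz : z ∈ tile α r)
    (hw : w ∈ tile α s) : |(z - w).1| ≤ 1.61 := by
  obtain ⟨δ, -, rfl⟩ := hz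
  obtain ⟨δ', -, rfl⟩ := hw
  have h := ((summable_term hα δ).hasSum.sub (summable_term hα δ').hasSum).mapL
    (ContinuousLinearMap.fst ℝ ℝ ℂ)
  have := h.norm_le_of_bounded (hasSum_geom_four (r := 0.775) (by norm_num) (by norm_num)) fun n => by
    have hp : |α.1| ^ (n + 4) ≤ 0.775 ^ (n + 4) := pow_le_pow_left₀ (abs_nonneg _) hα.norm_fst _
    have h0 : (0 : ℝ) ≤ 0.775 ^ (n + 4) := by positivity
    cases h1 : δ n <;> cases h2 : δ' n <;> simpa [term, h1, h2] using by assumption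
  refine le_trans this ?_
  norm_num

lemma snd_sub_le (hα : RootBounds α) {r s : ℕ} {z w : ℝ × ℂ} (hz : z ∈ tile α r)
    (hw : w ∈ tile α s) : ‖(z - w).2‖ ≤ 2.52 := by
  obtain ⟨δ, -, rfl⟩ := hz
  obtain ⟨δ', -, rfl⟩ := hw
  have h := ((summable_term hα δ).hasSum.sub (summable_term hα δ').hasSum).mapL
    (ContinuousLinearMap.snd ℝ ℝ ℂ)
  have := h.norm_le_of_bounded (hasSum_geom_four (r := 0.82) (by norm_num) (by norm_num)) fun n => by
    have hp : ‖α.2‖ ^ (n + 4) ≤ 0.82 ^ (n + 4) := pow_le_pow_left₀ (norm_nonneg _) hα.norm_snd _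
    have h0 : (0 : ℝ) ≤ 0.82 ^ (n + 4) := by positivity
    cases h1 : δ n <;> cases h2 : δ' n <;> simpa [term, h1, h2] using by assumption
  refine le_trans this ?_
  norm_num

end Tile
end Tetranacci
end

/-! ### Pairs of expansions and the finite graph of their differences -/

noncomputable section
namespace Tetranacci

/-- The points `z` of a tile such that `z - y` is in a tile. -/
def pair (α : ℝ × ℂ) (y : Vec) (r s : ℕ) : Set (ℝ × ℂ) :=
  {z | z ∈ tile α r ∧ z - ev α y ∈ tile α s}

/-- The linear combination of `1, α, α², α³` with real coefficients. -/
def realEv (α : ℝ × ℂ) (a b c d : ℝ) : ℝ × ℂ := a • 1 + b • α + c • α ^ 2 + d • α ^ 3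

lemma ev_eq_realEv (α : ℝ × ℂ) (x : Vec) : ev α x = realEv α x.1 x.2.1 x.2.2.1 x.2.2.2 := by
  ext <;> simp [ev, realEv]

/-- Replaces powers of `α` by integer multiples of `10⁻³`, at the cost of one unit per coordinate,
so that excluding a difference becomes an inequality between integers. -/
lemma linear_bound {u₁ u₂ u₃ f₁ f₂ f₃ : ℝ} (h₁ : |1000 * u₁ - f₁| ≤ 1) (h₂ : |1000 * u₂ - f₂| ≤ 1)
    (h₃ : |1000 * u₃ - f₃| ≤ 1) (a b c d : ℝ) :
    |1000 * a + f₁ * b + f₂ * c + f₃ * d| ≤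
      1000 * |a + b * u₁ + c * u₂ + d * u₃| + |b| + |c| + |d| := by
  have e : 1000 * a + f₁ * b + f₂ * c + f₃ * d = 1000 * (a + b * u₁ + c * u₂ + d * u₃)
      - b * (1000 * u₁ - f₁) - c * (1000 * u₂ - f₂) - d * (1000 * u₃ - f₃) := by ring
  have k : ∀ {x y : ℝ}, |y| ≤ 1 → |x * y| ≤ |x| := fun {x y} h => by
    rw [abs_mul]; exact mul_le_of_le_one_right (abs_nonneg _) h
  rw [e]
  refine (abs_sub _ _).trans ?_
  have t1 := abs_sub (1000 * (a + b * u₁ + c * u₂ + d * u₃) - b * (1000 * u₁ - f₁))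
    (c * (1000 * u₂ - f₂))
  have t2 := abs_sub (1000 * (a + b * u₁ + c * u₂ + d * u₃)) (b * (1000 * u₁ - f₁))
  have t3 : |1000 * (a + b * u₁ + c * u₂ + d * u₃)| = 1000 * |a + b * u₁ + c * u₂ + d * u₃| := by
    rw [abs_mul, abs_of_pos (by norm_num : (0 : ℝ) < 1000)]
  linarith [k (x := b) h₁, k (x := c) h₂, k (x := d) h₃]

section Bounds
variable {α : ℝ × ℂ}

lemma realEv_fst_bound (hα : RootBounds α) (a b c d : ℝ) :
    |1000 * a + (-775) * b + 600 * c + (-465) * d| ≤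
      1000 * |(realEv α a b c d).1| + |b| + |c| + |d| := by
  have := linear_bound hα.fst_one hα.fst_two hα.fst_three a b c d
  simpa [realEv] using this

lemma realEv_re_bound (hα : RootBounds α) (a b c d : ℝ) :
    |1000 * a + (-76) * b + (-658) * c + 152 * d| ≤
      1000 * |(realEv α a b c d).2.re| + |b| + |c| + |d| := by
  have := linear_bound hα.re_one hα.re_two hα.re_three a b c d
  simpa only [realEv, Prod.snd_add, Prod.smul_snd, Prod.pow_snd, Prod.snd_one, Complex.add_re,
    Complex.smul_re, Complex.one_re, smul_eq_mul, mul_one] using this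

lemma realEv_im_bound (hα : RootBounds α) (a b c d : ℝ) :
    |815 * b + (-124) * c + (-526) * d| ≤
      1000 * |(realEv α a b c d).2.im| + |b| + |c| + |d| := by
  have := linear_bound hα.im_one hα.im_two hα.im_three 0 b c d
  simpa only [realEv, Prod.snd_add, Prod.smul_snd, Prod.pow_snd, Prod.snd_one, Complex.add_im,
    Complex.smul_im, Complex.one_im, smul_eq_mul, mul_zero, zero_add] using this

lemma blt_eq_false_iff {t F : ℕ} : Nat.blt t F = false ↔ F ≤ t := by
  rw [← Bool.not_eq_true, Nat.blt_eq, not_lt]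

/-- A linear form on `ev α x` is too large for a difference of two points of the tiles. -/
def oob (x : Vec) : Bool :=
  let t := x.2.1.natAbs + x.2.2.1.natAbs + x.2.2.2.natAbs
  Nat.blt (1610 + t) (1000 * x.1 + (-775) * x.2.1 + 600 * x.2.2.1 + (-465) * x.2.2.2).natAbs ||
  (Nat.blt (2520 + t) (1000 * x.1 + (-76) * x.2.1 + (-658) * x.2.2.1 + 152 * x.2.2.2).natAbs ||
  Nat.blt (2520 + t) (815 * x.2.1 + (-124) * x.2.2.1 + (-526) * x.2.2.2).natAbs)

lemma ev_bounds (hα : RootBounds α) {x : Vec} {r s : ℕ} {z : ℝ × ℂ} (hz : z ∈ pair α x r s) :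
    |(ev α x).1| ≤ 1.61 ∧ |(ev α x).2.re| ≤ 2.52 ∧ |(ev α x).2.im| ≤ 2.52 := by
  have h1 := fst_sub_le hα hz.1 hz.2
  have h2 := snd_sub_le hα hz.1 hz.2
  rw [sub_sub_cancel] at h1 h2
  exact ⟨h1, (Complex.abs_re_le_norm _).trans h2, (Complex.abs_im_le_norm _).trans h2⟩

lemma oob_eq_false (hα : RootBounds α) {x : Vec} {r s : ℕ} {z : ℝ × ℂ} (hz : z ∈ pair α x r s) :
    oob x = false := by
  obtain ⟨h1, h2, h3⟩ := ev_bounds hα hz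
  rw [ev_eq_realEv] at h1 h2 h3
  have k1 := realEv_fst_bound hα x.1 x.2.1 x.2.2.1 x.2.2.2
  have k2 := realEv_re_bound hα x.1 x.2.1 x.2.2.1 x.2.2.2
  have k3 := realEv_im_bound hα x.1 x.2.1 x.2.2.1 x.2.2.2
  have key : ∀ (t : ℕ) (F : ℤ), |(F : ℝ)| ≤ t → Nat.blt t F.natAbs = false := by
    intro t F h
    rw [← Int.cast_abs, Int.abs_eq_natAbs] at h
    exact blt_eq_false_iff.2 (by exact_mod_cast h)
  have hn : ∀ n : ℤ, (n.natAbs : ℝ) = |(n : ℝ)| := fun n => by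
    rw [← Int.cast_abs, Int.abs_eq_natAbs]; rfl
  simp only [oob, Bool.or_eq_false_iff]
  refine ⟨key _ _ ?_, key _ _ ?_, key _ _ ?_⟩ <;> push_cast [hn] <;> linarith

/-- The transition rule of the graph. All later set identities come from iterating it. -/
lemma mem_pair_iff (hα : RootBounds α) {y : Vec} {r s : ℕ} {z : ℝ × ℂ} :
    z ∈ pair α y r s ↔ r ≤ 3 ∧ s ≤ 3 ∧ ∃ p q, ∃ w ∈ pair α (child y p q) (next p r) (next q s),
      z = digit α p + α * w := by
  constructor
  · rintro ⟨h1, h2⟩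
    obtain ⟨hr, p, w, hw, e1⟩ := (mem_tile_iff hα).1 h1
    obtain ⟨hs, q, w', hw', e2⟩ := (mem_tile_iff hα).1 h2
    refine ⟨hr, hs, p, q, w, ⟨hw, ?_⟩, e1⟩
    have : w - ev α (child y p q) = w' := mul_left_cancel_pow hα 1 (by
      linear_combination -e1 + e2 - mul_ev_child hα y p q)
    rwa [this]
  · rintro ⟨hr, hs, p, q, w, ⟨h1, h2⟩, e⟩
    refine ⟨(mem_tile_iff hα).2 ⟨hr, p, w, h1, e⟩, (mem_tile_iff hα).2 ⟨hs, q, _, h2, ?_⟩⟩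
    linear_combination e + mul_ev_child hα y p q

lemma pair_mono (α : ℝ × ℂ) (y : Vec) {r s r' s' : ℕ} (hr : r' ≤ r) (hs : s' ≤ s) :
    pair α y r s ⊆ pair α y r' s' := fun _ h => ⟨tile_anti α hr h.1, tile_anti α hs h.2⟩

lemma sub_mem_pair_neg {y : Vec} {r s : ℕ} {z : ℝ × ℂ} (hz : z ∈ pair α y r s) :
    z - ev α y ∈ pair α (-y) s r :=
  ⟨hz.2, by rw [ev_neg, sub_neg_eq_add, sub_add_cancel]; exact hz.1⟩

lemma child_self (y : Vec) (p : Bool) : child y p p = child y false false := by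
  simp [child]

/-- The tree of the descendants of `x` dies out within `n` steps. -/
def dead : ℕ → Vec → Bool
  | 0, x => oob x
  | n + 1, x => oob x || (dead n (child x false false) && (dead n (child x true false) &&
      dead n (child x false true)))

/-- The search ignores runs, so it excludes all `r`, `s` at once. Equal digits `0, 0` and `1, 1`
give the same difference, which leaves three children. -/
lemma not_mem_pair_of_dead (hα : RootBounds α) {n : ℕ} {x : Vec} (h : dead n x = true) {r s : ℕ}
    {z : ℝ × ℂ} : z ∉ pair α x r s := by
  induction n generalizing x r s z with
  | zero =>
    intro hz
    rw [dead, oob_eq_false hα hz] at h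
    cases h
  | succ n ih =>
    intro hz
    rw [dead, oob_eq_false hα hz, Bool.false_or, Bool.and_eq_true, Bool.and_eq_true] at h
    obtain ⟨-, -, p, q, w, hw, -⟩ := (mem_pair_iff hα).1 hz
    cases p <;> cases q
    · exact ih h.1 hw
    · exact ih h.2.2 hw
    · exact ih h.2.1 hw
    · rw [child_self] at hw
      exact ih h.1 hw

end Bounds

/-- The differences along infinite paths, other than `0`. -/
def alive : List Vec :=
  [(-1, -2, -1, 0), (-1, -1, -1, 0), (-1, -1, 0, -1), (-1, -1, 0, 0), (-1, 0, -1, -1),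
    (-1, 0, -1, 0), (-1, 0, 0, -1), (-1, 0, 0, 0), (-1, 0, 1, 0), (0, -1, -1, 0), (0, -1, 0, -1),
    (0, -1, 0, 0), (0, -1, 0, 1), (0, 0, -1, 0), (0, 0, 1, 0), (0, 1, 0, -1), (0, 1, 0, 0),
    (0, 1, 0, 1), (0, 1, 1, 0), (1, 0, -1, 0), (1, 0, 0, 0), (1, 0, 0, 1), (1, 0, 1, 0),
    (1, 0, 1, 1), (1, 1, 0, 0), (1, 1, 0, 1), (1, 1, 1, 0), (1, 2, 1, 0)]

/-- Exhaustive search: every edge leaving `alive` leads into a tree that dies within ten steps, so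
infinite paths stay in `alive`. -/
lemma child_alive_or_dead : ∀ x ∈ alive, ∀ p q : Bool,
    child x p q ∈ alive ∨ dead 10 (child x p q) = true := by
  decide +kernel

def boxVec (i j k : ℕ) : Vec := ((i : ℤ) - 6, (j : ℤ) - 5, (k : ℤ) - 5, 0)

lemma alive_or_dead_of_box : ∀ (i : Fin 13) (j k : Fin 11),
    boxVec i j k = 0 ∨ boxVec i j k ∈ alive ∨ dead 10 (boxVec i j k) = true := by
  decide +kernel

section Alive
variable {α : ℝ × ℂ}

lemma child_mem_alive (hα : RootBounds α) {x : Vec} (hx : x ∈ alive) {p q : Bool} {r s : ℕ}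
    {z : ℝ × ℂ} (hz : z ∈ pair α (child x p q) r s) : child x p q ∈ alive :=
  (child_alive_or_dead x hx p q).resolve_right fun h => not_mem_pair_of_dead hα h hz

/-- Bounds on the coordinates in terms of bounds on the components. -/
lemma coord_bounds (hα : RootBounds α) {a b c B : ℝ} (h1 : |(realEv α a b c 0).1| ≤ B)
    (h2 : |(realEv α a b c 0).2.re| ≤ B) (h3 : |(realEv α a b c 0).2.im| ≤ B) :
    |a| ≤ 5 * B ∧ |b| ≤ 5 * B ∧ |c| ≤ 5 * B := by
  have k1 := realEv_fst_bound hα a b c 0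
  have k2 := realEv_re_bound hα a b c 0
  have k3 := realEv_im_bound hα a b c 0
  simp only [abs_zero, mul_zero, add_zero] at k1 k2 k3
  have hb : 815 * |b| ≤ 124 * |c| + 1000 * B + |b| + |c| := by
    have := abs_sub_abs_le_abs_sub (815 * b) (124 * c)
    rw [abs_mul, abs_mul, abs_of_pos (by norm_num : (0 : ℝ) < 815),
      abs_of_pos (by norm_num : (0 : ℝ) < 124)] at this
    have e : 815 * b - 124 * c = 815 * b + (-124) * c := by ring
    rw [e] at this
    linarith
  -- Subtracting the second form from the first eliminates `a`; the imaginary form, which has no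
  -- `a`, gave `hb`.
  have hc : 1258 * |c| ≤ 699 * |b| + 2000 * B + 2 * |b| + 2 * |c| := by
    have t := abs_sub (1000 * a + (-775) * b + 600 * c) (1000 * a + (-76) * b + (-658) * c)
    have := abs_sub_abs_le_abs_sub (1258 * c) (699 * b)
    rw [abs_mul, abs_mul, abs_of_pos (by norm_num : (0 : ℝ) < 1258),
      abs_of_pos (by norm_num : (0 : ℝ) < 699)] at this
    have e : 1258 * c - 699 * b =
      (1000 * a + (-775) * b + 600 * c) - (1000 * a + (-76) * b + (-658) * c) := by ring
    rw [e] at this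
    linarith
  have ha : 1000 * |a| ≤ 775 * |b| + 600 * |c| + 1000 * B + |b| + |c| := by
    have t := abs_sub (1000 * a + (-775) * b + 600 * c) ((-775) * b + 600 * c)
    have t' := abs_add_le ((-775) * b) (600 * c)
    rw [abs_mul, abs_mul, abs_of_neg (by norm_num : (-775 : ℝ) < 0),
      abs_of_pos (by norm_num : (0 : ℝ) < 600)] at t'
    have e : 1000 * a = (1000 * a + (-775) * b + 600 * c) - ((-775) * b + 600 * c) := by ring
    have e' : 1000 * |a| = |1000 * a| := by
      rw [abs_mul, abs_of_pos (by norm_num : (0 : ℝ) < 1000)]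
    rw [e', e]
    linarith
  have := abs_nonneg b
  have := abs_nonneg c
  exact ⟨by linarith, by linarith, by linarith⟩

lemma natAbs_bounds (hα : RootBounds α) {m n k : ℤ} {r s : ℕ} {z : ℝ × ℂ}
    (hz : z ∈ pair α (m, n, k, 0) r s) : m.natAbs ≤ 6 ∧ n.natAbs ≤ 5 ∧ k.natAbs ≤ 5 := by
  have h := oob_eq_false hα hz
  simp only [oob, Bool.or_eq_false_iff, blt_eq_false_iff] at h
  obtain ⟨h1, h2, h3⟩ := h
  omega

lemma mem_alive_of_mem_pair (hα : RootBounds α) {m n k : ℤ} {r s : ℕ} {z : ℝ × ℂ}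
    (hz : z ∈ pair α (m, n, k, 0) r s) (h0 : ((m, n, k, 0) : Vec) ≠ 0) :
    ((m, n, k, 0) : Vec) ∈ alive := by
  obtain ⟨h1, h2, h3⟩ := natAbs_bounds hα hz
  have := alive_or_dead_of_box ⟨(m + 6).toNat, by omega⟩ ⟨(n + 5).toNat, by omega⟩
    ⟨(k + 5).toNat, by omega⟩
  rw [boxVec, show (((m + 6).toNat : ℕ) : ℤ) - 6 = m by omega,
    show (((n + 5).toNat : ℕ) : ℤ) - 5 = n by omega,
    show (((k + 5).toNat : ℕ) : ℤ) - 5 = k by omega] at this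
  exact (this.resolve_left h0).resolve_right fun h => not_mem_pair_of_dead hα h hz

end Alive
end Tetranacci
end

/-! ### Certificates for inclusions and for periodic points -/

noncomputable section
namespace Tetranacci

/-- The data of an affine image of a set `pair α y r s`. -/
structure Piece where
  e : Vec
  k : ℕ
  y : Vec
  r : ℕ
  s : ℕ

def Piece.carrier (α : ℝ × ℂ) (P : Piece) : Set (ℝ × ℂ) :=
  (fun w => ev α P.e + α ^ P.k * w) '' pair α P.y P.r P.s

/-- A sufficient condition for `ev e + α ^ k * pair y r s` to be contained in `P`. -/
def Piece.Contains (P : Piece) (e : Vec) (k : ℕ) (y : Vec) (r s : ℕ) : Bool :=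
  decide (P.k = k) && (decide (P.y = y ∧ P.e = e ∧ P.r ≤ r ∧ P.s ≤ s) ||
    decide (y = -P.y ∧ e = P.e + up^[k] P.y ∧ P.r ≤ s ∧ P.s ≤ r))

/-- The coordinates of `(1 - α ^ 4) * ev α e`. -/
def oneSub (e : Vec) : Vec := e - up^[4] e

/-- Unfold `ev e + α ^ k * pair y r s` until every branch is empty, is contained in one of the
pieces, or is a point `ev v / (1 - α ^ 4)` with `v` in `pts`, according to the table `tab` of the
sets `pair` which are points. -/
def cover (tab : List (Vec × Vec)) (pcs : List Piece) (pts : List Vec) :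
    ℕ → Vec → ℕ → Vec → ℕ → ℕ → Bool
  | 0, _, _, _, _, _ => false
  | n + 1, e, k, y, r, s =>
    decide (3 < r) || (decide (3 < s) || (pcs.any (fun P => P.Contains e k y r s) ||
    (tab.any (fun t => decide (t.1 = y ∧ oneSub e + up^[k] t.2 ∈ pts)) ||
    [(false, false), (false, true), (true, false), (true, true)].all fun c =>
      decide (child y c.1 c.2 ∉ alive) ||
        cover tab pcs pts n (e + up^[k] (lead c.1)) (k + 1) (child y c.1 c.2)
          (next c.1 r) (next c.2 s))))

section Cover
variable {α : ℝ × ℂ}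

lemma ev_oneSub (hα : RootBounds α) (e : Vec) : ev α (oneSub e) = (1 - α ^ 4) * ev α e := by
  rw [oneSub, ev_sub, ev_up_iterate hα]; ring

lemma mem_carrier_of_contains (hα : RootBounds α) {P : Piece} {e : Vec} {k : ℕ} {y : Vec}
    {r s : ℕ} (h : P.Contains e k y r s = true) {z : ℝ × ℂ} (hz : z ∈ pair α y r s) :
    ev α e + α ^ k * z ∈ P.carrier α := by
  simp only [Piece.Contains, Bool.and_eq_true, Bool.or_eq_true, decide_eq_true_eq] at h
  obtain ⟨rfl, ⟨rfl, rfl, h1, h2⟩ | ⟨rfl, rfl, h1, h2⟩⟩ := h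
  · exact ⟨z, pair_mono α _ h1 h2 hz, rfl⟩
  · have := sub_mem_pair_neg hz
    rw [neg_neg] at this
    refine ⟨_, pair_mono α _ h1 h2 this, ?_⟩
    simp only [ev_add, ev_up_iterate hα, ev_neg]
    ring

/-- Induction on the fuel `n`. The point `ev α e + α ^ k * z` does not change along a path, since
`e` absorbs each digit read. Multiplying points by `1 - α ^ 4` keeps their coordinates integral. -/
lemma cover_sound (hα : RootBounds α) {tab : List (Vec × Vec)} {pcs : List Piece} {pts : List Vec}
    (htab : ∀ t ∈ tab, ∀ z ∈ pair α t.1 0 0, (1 - α ^ 4) * z = ev α t.2) {n : ℕ} {e : Vec} {k : ℕ}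
    {y : Vec} {r s : ℕ} (hy : y ∈ alive) (h : cover tab pcs pts n e k y r s = true)
    {z : ℝ × ℂ} (hz : z ∈ pair α y r s) :
    (∃ P ∈ pcs, ev α e + α ^ k * z ∈ P.carrier α) ∨
      ∃ v ∈ pts, (1 - α ^ 4) * (ev α e + α ^ k * z) = ev α v := by
  induction n generalizing e k y r s z with
  | zero => cases h
  | succ n ih =>
    rw [cover, Bool.or_eq_true, Bool.or_eq_true, Bool.or_eq_true, Bool.or_eq_true,
      decide_eq_true_eq, decide_eq_true_eq, List.any_eq_true, List.any_eq_true,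
      List.all_eq_true] at h
    obtain ⟨hr, hs, p, q, w, hw, rfl⟩ := (mem_pair_iff hα).1 hz
    rcases h with h | h | ⟨P, hP, h⟩ | ⟨t, ht, h⟩ | h
    · omega
    · omega
    · exact Or.inl ⟨P, hP, mem_carrier_of_contains hα h hz⟩
    · obtain ⟨rfl, hv⟩ := of_decide_eq_true h
      refine Or.inr ⟨_, hv, ?_⟩
      rw [ev_add, ev_oneSub hα, ev_up_iterate hα,
        ← htab t ht _ (pair_mono α _ (Nat.zero_le _) (Nat.zero_le _) hz)]
      ring
    · have h1 := h (p, q) (by cases p <;> cases q <;> simp)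
      have hc := child_mem_alive hα hy hw
      rw [Bool.or_eq_true, decide_eq_true_eq] at h1
      have := ih hc (h1.resolve_left (not_not.2 hc)) hw
      have e1 : ev α (e + up^[k] (lead p)) + α ^ (k + 1) * w =
          ev α e + α ^ k * (digit α p + α * w) := by
        rw [ev_add, ev_up_iterate hα, ev_lead hα]; ring
      rwa [e1] at this

/-- Follow a path from the state `(y, r, s)`, keeping track of `e = ev⁻¹ (ev P.e - digits)`. -/
def inPath (P : Piece) : List (Bool × Bool) → Vec → Vec → ℕ → ℕ → Bool
  | [], e, y, r, s => decide (e = 0 ∧ y = P.y ∧ r ≤ P.r ∧ s ≤ P.s) ||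
      decide (e = -P.y ∧ y = -P.y ∧ r ≤ P.s ∧ s ≤ P.r)
  | c :: l, e, y, r, s => decide (r ≤ 3) && (decide (s ≤ 3) &&
      inPath P l (down (e - lead c.1)) (child y c.1 c.2) (next c.1 r) (next c.2 s))

lemma inPath_sound (hα : RootBounds α) {P : Piece} {l : List (Bool × Bool)} {e y : Vec}
    {r s : ℕ} (h : inPath P l e y r s = true) {w : ℝ × ℂ} (hw : w ∈ pair α P.y P.r P.s) :
    ev α e + α ^ l.length * w ∈ pair α y r s := by
  induction l generalizing e y r s with
  | nil =>
    simp only [inPath, Bool.or_eq_true, decide_eq_true_eq] at h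
    obtain ⟨rfl, rfl, h1, h2⟩ | ⟨rfl, rfl, h1, h2⟩ := h
    · simpa using pair_mono α _ h1 h2 hw
    · have := pair_mono α _ h1 h2 (sub_mem_pair_neg hw)
      rw [sub_eq_neg_add] at this
      simpa [ev_neg] using this
  | cons c l ih =>
    simp only [inPath, Bool.and_eq_true, decide_eq_true_eq] at h
    refine (mem_pair_iff hα).2 ⟨h.1, h.2.1, c.1, c.2, _, ih h.2.2, ?_⟩
    have := mul_ev_down hα (e - lead c.1)
    rw [ev_sub, ev_lead hα] at this
    rw [List.length_cons]
    linear_combination -this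

lemma carrier_subset (hα : RootBounds α) {P : Piece} {y : Vec} {r s : ℕ}
    (l : List (Bool × Bool)) (hl : l.length = P.k) (h : inPath P l P.e y r s = true) :
    P.carrier α ⊆ pair α y r s := by
  rintro _ ⟨w, hw, rfl⟩
  rw [← hl]
  exact inPath_sound hα h hw

/-- The coordinates of the number with the given digits, the first one of weight `α ^ 4`. -/
def digitSum : List Bool → Vec
  | [] => 0
  | p :: l => lead p + up (digitSum l)

def endRun : List Bool → ℕ → ℕ
  | [], r => r
  | p :: l, r => endRun l (next p r)

def allowed : List Bool → ℕ → Bool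
  | [], _ => true
  | p :: l, r => decide (r ≤ 3) && allowed l (next p r)

lemma digitSum_add_mem_tile (hα : RootBounds α) {l : List Bool} {r : ℕ} (h : allowed l r = true)
    {w : ℝ × ℂ} (hw : w ∈ tile α (endRun l r)) :
    ev α (digitSum l) + α ^ l.length * w ∈ tile α r := by
  induction l generalizing r with
  | nil => simpa [digitSum, endRun] using hw
  | cons p l ih =>
    simp only [allowed, Bool.and_eq_true, decide_eq_true_eq] at h
    refine (mem_tile_iff hα).2 ⟨h.1, p, _, ih h.2 hw, ?_⟩
    rw [digitSum, ev_add, ev_up hα, ev_lead hα, List.length_cons]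
    ring

lemma tendsto_pow_mul (hα : RootBounds α) {k : ℕ} (hk : k ≠ 0) (z : ℝ × ℂ) :
    Filter.Tendsto (fun n : ℕ => (α ^ k) ^ n * z) Filter.atTop (nhds 0) := by
  have h1 : ‖α ^ k‖ < 1 :=
    lt_of_le_of_lt (norm_pow_le' α (Nat.pos_of_ne_zero hk))
      (pow_lt_one₀ (norm_nonneg _) (norm_lt_one hα) hk)
  simpa using (tendsto_pow_atTop_nhds_zero_of_norm_lt_one h1).mul_const z

/-- The iterates of any point of `S` stay in `S` and converge to the fixed point of the contraction.
-/
lemma fixed_point_mem (hα : RootBounds α) {k : ℕ} (hk : k ≠ 0) {E c z : ℝ × ℂ}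
    {S : Set (ℝ × ℂ)} (hS : IsClosed S) (hz : z ∈ S) (h : ∀ w ∈ S, E + α ^ k * w ∈ S)
    (hc : (1 - α ^ k) * c = E) : c ∈ S := by
  have h1 : ∀ n : ℕ, c + (α ^ k) ^ n * (z - c) ∈ S := by
    intro n
    induction n with
    | zero => simpa using hz
    | succ n ih =>
      have := h _ ih
      rw [← hc] at this
      convert this using 1
      ring
  have h2 := (tendsto_pow_mul hα hk (z - c)).const_add c
  rw [add_zero] at h2
  exact hS.mem_of_tendsto h2 (Filter.Eventually.of_forall h1)

/-- Each point of `S` has an `n`-th preimage in `S` for every `n`. Its distance to the fixed point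
is thus at most `‖α ^ k‖ ^ n` times a constant, hence zero. -/
lemma eq_fixed_point (hα : RootBounds α) {k : ℕ} (hk : k ≠ 0) {E : ℝ × ℂ}
    {S : Set (ℝ × ℂ)} (hS : Bornology.IsBounded S) (h : ∀ z ∈ S, ∃ w ∈ S, z = E + α ^ k * w)
    {z : ℝ × ℂ} (hz : z ∈ S) : (1 - α ^ k) * z = E := by
  obtain ⟨γ, hγ⟩ := exists_inverse_one_sub hα hk
  have hc : (1 - α ^ k) * (γ * E) = E := by rw [← mul_assoc, hγ, one_mul]
  suffices z = γ * E by rw [this, hc]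
  have h1 : ∀ n : ℕ, ∀ z ∈ S, ∃ w ∈ S, z - γ * E = (α ^ k) ^ n * (w - γ * E) := by
    intro n
    induction n with
    | zero => exact fun z hz => ⟨z, hz, by simp⟩
    | succ n ih =>
      intro z hz
      obtain ⟨w, hw, e1⟩ := ih z hz
      obtain ⟨w', hw', e2⟩ := h w hw
      refine ⟨w', hw', ?_⟩
      rw [e1, e2, pow_succ, mul_assoc]
      congr 1
      linear_combination -hc
  obtain ⟨C, hC⟩ := hS.exists_norm_le
  choose w hw e using fun n => h1 n z hz
  have h2 : ∀ n : ℕ, ‖z - γ * E‖ ≤ ‖α ^ k‖ ^ n * (C + ‖γ * E‖) := by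
    intro n
    rw [e n]
    refine (norm_mul_le _ _).trans ?_
    have h3 : ‖w n - γ * E‖ ≤ C + ‖γ * E‖ :=
      (norm_sub_le _ _).trans (by linarith [hC _ (hw n)])
    gcongr
    exact norm_pow_le _ _
  have h1 : ‖α ^ k‖ < 1 :=
    lt_of_le_of_lt (norm_pow_le' α (Nat.pos_of_ne_zero hk))
      (pow_lt_one₀ (norm_nonneg _) (norm_lt_one hα) hk)
  have h4 := (tendsto_pow_atTop_nhds_zero_of_lt_one (norm_nonneg _) h1).mul_const (C + ‖γ * E‖)
  rw [zero_mul] at h4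
  have h5 := ge_of_tendsto' h4 h2
  exact sub_eq_zero.1 (norm_le_zero_iff.1 h5)

/-- The eventually periodic sequence of digits `a b b b ...` is allowed after `r` digits `1`, and
represents `ev v / (1 - α ^ 4)`. -/
def periodic (v : Vec) (r : ℕ) (a b : List Bool) : Bool :=
  decide (v = oneSub (digitSum a) + up^[a.length] (digitSum b)) && (decide (b.length = 4) &&
    (allowed a r && (allowed b (endRun a r) &&
      decide (endRun a r ≤ 3 ∧ endRun b (endRun a r) ≤ endRun a r))))

lemma mem_tile_of_periodic (hα : RootBounds α) {v : Vec} {r : ℕ} {a b : List Bool}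
    (h : periodic v r a b = true) {z : ℝ × ℂ} (hz : (1 - α ^ 4) * z = ev α v) :
    z ∈ tile α r := by
  simp only [periodic, Bool.and_eq_true, decide_eq_true_eq] at h
  obtain ⟨hv, hb, h1, h2, h3, h4⟩ := h
  obtain ⟨γ, hγ⟩ := exists_inverse_one_sub hα (k := 4) (by norm_num)
  have hc : (1 - α ^ 4) * (γ * ev α (digitSum b)) = ev α (digitSum b) := by
    rw [← mul_assoc, hγ, one_mul]
  -- The purely periodic tail. Reading `b` ends with a run no longer than the one before it, so the
  -- block can be repeated, by `tile_anti`.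
  have h5 : γ * ev α (digitSum b) ∈ tile α (endRun a r) := by
    refine fixed_point_mem hα (k := 4) (by norm_num) (isCompact_tile hα _).isClosed
      (zero_mem_tile α h3) (fun w hw => ?_) hc
    rw [← hb]
    exact digitSum_add_mem_tile hα h2 (tile_anti α h4 hw)
  have h6 := digitSum_add_mem_tile hα h1 h5
  convert h6 using 1
  refine mul_left_cancel_one_sub hα (k := 4) (by norm_num) ?_
  rw [hz, hv, ev_add, ev_oneSub hα, ev_up_iterate hα]
  linear_combination -α ^ a.length * hc

def periodicPair (v y : Vec) (r s : ℕ) (a b a' b' : List Bool) : Bool :=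
  periodic v r a b && periodic (v - oneSub y) s a' b'

lemma mem_pair_of_periodic (hα : RootBounds α) {v y : Vec} {r s : ℕ} {a b a' b' : List Bool}
    (h : periodicPair v y r s a b a' b' = true) {z : ℝ × ℂ}
    (hz : (1 - α ^ 4) * z = ev α v) : z ∈ pair α y r s := by
  simp only [periodicPair, Bool.and_eq_true] at h
  refine ⟨mem_tile_of_periodic hα h.1 hz, mem_tile_of_periodic hα h.2 ?_⟩
  rw [ev_sub, ev_oneSub hα, ← hz, mul_sub]

lemma mem_carrier_of_periodic (hα : RootBounds α) {v : Vec} (P : Piece) (a b a' b' : List Bool)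
    (h : periodicPair (down^[P.k] (v - oneSub P.e)) P.y P.r P.s a b a' b' = true) {z : ℝ × ℂ}
    (hz : (1 - α ^ 4) * z = ev α v) : z ∈ P.carrier α := by
  obtain ⟨w, hw⟩ := exists_pow_mul_eq hα P.k (z - ev α P.e)
  refine ⟨w, mem_pair_of_periodic hα h ?_, by simp only [hw]; ring⟩
  refine mul_left_cancel_pow hα P.k ?_
  rw [mul_ev_down_iterate hα, ev_sub, ev_oneSub hα, ← hz]
  linear_combination (1 - α ^ 4) * hw

/-- The sets `pair` which are points, and the points, multiplied by `1 - α ^ 4`. -/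
def points : List (Vec × Vec) :=
  [((1, 0, -1, 0), (5, 7, 8, 9)), ((-1, -2, -1, 0), (6, 9, 11, 12)), ((1, 2, 1, 0), (2, 3, 3, 3)),
    ((-1, 0, -1, 0), (5, 8, 9, 10)), ((1, 0, 1, 0), (3, 4, 5, 5)), ((-1, 0, 1, 0), (3, 5, 6, 6))]

/-- From each of these differences every surviving path of length four closes up with the same
translation, so the set is contained in its image under a single contraction. -/
lemma cover_points : ∀ t ∈ points, t.1 ∈ alive ∧
    cover [] [⟨t.2, 4, t.1, 0, 0⟩] [] 5 0 0 t.1 0 0 = true := by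
  decide +kernel

lemma eq_of_mem_points (hα : RootBounds α) :
    ∀ t ∈ points, ∀ z ∈ pair α t.1 0 0, (1 - α ^ 4) * z = ev α t.2 := by
  intro t ht z hz
  obtain ⟨h1, h2⟩ := cover_points t ht
  refine eq_fixed_point hα (k := 4) (by norm_num) (S := pair α t.1 0 0)
    ((isCompact_tile hα 0).isBounded.subset fun z hz => hz.1) (fun z hz => ?_) hz
  rcases cover_sound hα (by simp) h1 h2 hz with ⟨P, hP, h⟩ | ⟨v, hv, -⟩
  · rw [List.mem_singleton] at hP
    subst hP
    obtain ⟨w, hw, e⟩ := h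
    exact ⟨w, hw, by simpa using e.symm⟩
  · simp at hv

/-- A covering of a set `pair`. -/
lemma pair_subset (hα : RootBounds α) {pcs : List Piece} (pts : List Vec) {y : Vec} {r s : ℕ}
    (hy : y ∈ alive) (n : ℕ) (h : cover points pcs pts n 0 0 y r s = true) {S : Set (ℝ × ℂ)}
    (h1 : ∀ P ∈ pcs, P.carrier α ⊆ S) (h2 : ∀ v ∈ pts, ∀ z, (1 - α ^ 4) * z = ev α v → z ∈ S) :
    pair α y r s ⊆ S := by
  intro z hz
  rcases cover_sound hα (eq_of_mem_points hα) hy h hz with ⟨P, hP, h⟩ | ⟨v, hv, h⟩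
  · simpa using h1 P hP h
  · simpa using h2 v hv _ h

end Cover
end Tetranacci
end

/-! ### The decompositions of `X`, `Y` and the other regions -/

noncomputable section
namespace Tetranacci

abbrev vecX : Vec := (1, 1, 1, 0)

abbrev vecY : Vec := (1, 1, 0, 0)

def bits (l : List ℕ) : List Bool := l.map fun n => decide (n = 1)

/-- A sequence of pairs of digits, each pair being given by its value in base two. -/
def path (l : List ℕ) : List (Bool × Bool) := l.map fun n => (decide (2 ≤ n), decide (n % 2 = 1))

/-- Every path from the state `(y, r, s)` is also a path from `(y, r', s')`. -/
def coarser : ℕ → Vec → ℕ → ℕ → ℕ → ℕ → Bool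
  | 0, _, r, s, r', s' => decide (r' ≤ r ∧ s' ≤ s)
  | n + 1, y, r, s, r', s' => decide (r' ≤ r ∧ s' ≤ s) || (decide (r' ≤ 3 ∧ s' ≤ 3) &&
    [(false, false), (false, true), (true, false), (true, true)].all fun c =>
      decide (child y c.1 c.2 ∉ alive) ||
        coarser n (child y c.1 c.2) (next c.1 r) (next c.2 s) (next c.1 r') (next c.2 s'))

lemma pair_subset_of_coarser {α : ℝ × ℂ} (hα : RootBounds α) {n : ℕ} {y : Vec} {r s r' s' : ℕ}
    (hy : y ∈ alive) (h : coarser n y r s r' s' = true) : pair α y r s ⊆ pair α y r' s' := by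
  induction n generalizing y r s r' s' with
  | zero =>
    have h := of_decide_eq_true h
    exact pair_mono α y h.1 h.2
  | succ n ih =>
    simp only [coarser, Bool.or_eq_true, Bool.and_eq_true, decide_eq_true_eq,
      List.all_eq_true] at h
    rcases h with h | ⟨h1, h2⟩
    · exact pair_mono α y h.1 h.2
    · intro z hz
      obtain ⟨-, -, p, q, w, hw, rfl⟩ := (mem_pair_iff hα).1 hz
      have hc := child_mem_alive hα hy hw
      have h3 := (h2 (p, q) (by cases p <;> cases q <;> simp)).resolve_left (not_not.2 hc)
      exact (mem_pair_iff hα).2 ⟨h1.1, h1.2, p, q, w, ih hc h3 hw, rfl⟩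

/-- With `s = 3` the second sequence must begin with `0`, which the graph forces. Hence a path
reaching `X` after a run of `1` in that sequence still reaches all of `X`. -/
lemma pair_vecX_subset {α : ℝ × ℂ} (hα : RootBounds α) : pair α vecX 0 0 ⊆ pair α vecX 0 3 :=
  pair_subset_of_coarser hα (n := 2) (by decide) (by decide +kernel)

lemma pair_sq_subset {α : ℝ × ℂ} (hα : RootBounds α) :
    pair α (0, 0, 1, 0) 0 0 ⊆ pair α (0, 0, 1, 0) 0 1 :=
  pair_subset_of_coarser hα (n := 5) (by decide) (by decide +kernel)

/-- A first sequence beginning with `111` is allowed from runs `0, 0` but not after a `1`. Such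
paths go on through `(1, 0, -1, 0)`, a one-point set, and that point has another expansion that is
allowed. -/
lemma pair_vecY_subset {α : ℝ × ℂ} (hα : RootBounds α) : pair α vecY 0 0 ⊆ pair α vecY 1 3 := by
  refine pair_subset hα (pcs := [⟨(1, 1, 1, 1), 2, (-1, -1, 0, 0), 0, 0⟩,
    ⟨(2, 3, 3, 3), 3, (0, 1, 0, -1), 0, 0⟩, ⟨(2, 3, 3, 3), 3, (0, 1, 0, 0), 0, 1⟩,
    ⟨(2, 3, 3, 3), 3, (0, 1, 1, 0), 0, 2⟩]) [(16, 24, 28, 30)] (by decide) 6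
    (by decide +kernel) ?_ ?_
  · intro P hP
    simp only [List.mem_cons, List.not_mem_nil, or_false] at hP
    rcases hP with rfl | rfl | rfl | rfl
    · exact carrier_subset hα (path [2, 0]) rfl (by decide +kernel)
    · exact carrier_subset hα (path [2, 2, 0]) rfl (by decide +kernel)
    · exact carrier_subset hα (path [2, 2, 1]) rfl (by decide +kernel)
    · exact carrier_subset hα (path [2, 3, 1]) rfl (by decide +kernel)
  · intro v hv z hz
    rw [List.mem_singleton] at hv
    subst hv
    exact mem_pair_of_periodic hα (a := bits [1, 0, 0]) (b := bits [0, 1, 1, 0])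
      (a' := bits [0, 0, 1, 0]) (b' := bits [0, 1, 1, 0]) (by decide +kernel) hz

/-- The same set, with stronger conditions on the runs of `1`. -/
def Piece.restrict (P : Piece) : Piece :=
  if P.y = vecX then { P with r := 0, s := 3 }
  else if P.y = vecY then { P with r := 1, s := 3 }
  else if P.y = (0, 0, 1, 0) then { P with r := 0, s := 1 } else P

lemma Piece.restrict_e (P : Piece) : P.restrict.e = P.e := by
  unfold Piece.restrict
  split_ifs <;> rfl

lemma Piece.restrict_k (P : Piece) : P.restrict.k = P.k := by
  unfold Piece.restrict
  split_ifs <;> rfl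

/-- An affine image of a set `pair α y 0 0`, a path which leads to it, and some of its points with
periodic expansions. -/
structure Entry where
  e : Vec
  k : ℕ
  y : Vec
  route : List ℕ
  pts : List (Vec × List ℕ × List ℕ × List ℕ × List ℕ) := []

def Entry.piece (E : Entry) : Piece := ⟨E.e, E.k, E.y, 0, 0⟩

def Entry.check (E : Entry) (y : Vec) : Bool :=
  decide (E.route.length = E.k) && (inPath E.piece.restrict (path E.route) E.e y 0 0 &&
    E.pts.all fun t => periodicPair (down^[E.k] (t.1 - oneSub E.e)) E.y 0 0
      (bits t.2.1) (bits t.2.2.1) (bits t.2.2.2.1) (bits t.2.2.2.2))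

def decomposition (y : Vec) (L : List Entry) : Bool :=
  cover points (L.map Entry.piece) (L.flatMap fun E => E.pts.map Prod.fst) 9 0 0 y 0 0 &&
    L.all fun E => E.check y

section Decomposition
variable {α : ℝ × ℂ}

lemma carrier_subset_restrict (hα : RootBounds α) (E : Entry) :
    E.piece.carrier α ⊆ E.piece.restrict.carrier α := by
  unfold Piece.restrict
  split_ifs with h1 h2 h3
  · rintro _ ⟨w, hw, rfl⟩
    have h1 : E.y = vecX := h1
    refine ⟨w, ?_, rfl⟩
    simp only [Entry.piece, h1] at hw ⊢
    exact pair_vecX_subset hα hw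
  · rintro _ ⟨w, hw, rfl⟩
    have h2 : E.y = vecY := h2
    refine ⟨w, ?_, rfl⟩
    simp only [Entry.piece, h2] at hw ⊢
    exact pair_vecY_subset hα hw
  · rintro _ ⟨w, hw, rfl⟩
    have h3 : E.y = (0, 0, 1, 0) := h3
    refine ⟨w, ?_, rfl⟩
    simp only [Entry.piece, h3] at hw ⊢
    exact pair_sq_subset hα hw
  · exact subset_rfl

/-- `cover` gives one inclusion, with the branches ending in single points assigned to pieces by
periodic expansions. For the other, each route arrives at a restricted piece, which contains the
whole piece. -/
lemma mem_pair_iff_of_decomposition (hα : RootBounds α) {y : Vec} (hy : y ∈ alive)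
    (L : List Entry) (h : decomposition y L = true) {z : ℝ × ℂ} :
    z ∈ pair α y 0 0 ↔ ∃ E ∈ L, z ∈ E.piece.carrier α := by
  simp only [decomposition, Bool.and_eq_true, List.all_eq_true, Entry.check,
    decide_eq_true_eq] at h
  constructor
  · intro hz
    refine pair_subset hα _ hy 9 h.1 (S := {z | ∃ E ∈ L, z ∈ E.piece.carrier α}) ?_ ?_ hz
    · intro P hP z hz
      obtain ⟨E, hE, rfl⟩ := List.mem_map.1 hP
      exact ⟨E, hE, hz⟩
    · intro v hv z hz
      obtain ⟨E, hE, hv⟩ := List.mem_flatMap.1 hv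
      obtain ⟨t, ht, rfl⟩ := List.mem_map.1 hv
      exact ⟨E, hE, mem_carrier_of_periodic hα E.piece _ _ _ _ ((h.2 E hE).2.2 t ht) hz⟩
  · rintro ⟨E, hE, hz⟩
    obtain ⟨h1, h2, -⟩ := h.2 E hE
    have := carrier_subset hα (P := E.piece.restrict) (path E.route)
      (by rw [path, List.length_map, h1, Piece.restrict_k]; rfl)
      (by rw [Piece.restrict_e]; exact h2)
    exact this (carrier_subset_restrict hα E hz)

lemma region_ev (hα : RootBounds α) (x : Vec) : region α (ev α x) = pair α x 0 0 := by
  ext z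
  simp only [region, fractal_eq_tile hα, pair, Set.mem_inter_iff, Set.mem_image, Set.mem_ofPred_eq]
  refine and_congr_right fun _ => ⟨?_, fun h => ⟨_, h, sub_add_cancel _ _⟩⟩
  rintro ⟨w, hw, rfl⟩
  rwa [add_sub_cancel_right]

/-- The coordinates of `α ^ n`. -/
def powVec (n : ℕ) : Vec := up^[n] (1, 0, 0, 0)

lemma ev_powVec (hα : RootBounds α) (n : ℕ) : ev α (powVec n) = α ^ n := by
  rw [powVec, ev_up_iterate hα]; simp [ev]

def sumPow (l : List ℕ) : Vec := (l.map powVec).sum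

lemma ev_sumPow_cons (hα : RootBounds α) (n : ℕ) (l : List ℕ) :
    ev α (sumPow (n :: l)) = α ^ n + ev α (sumPow l) := by
  simp [sumPow, ev_add, ev_powVec hα]

lemma ev_sumPow_nil (α : ℝ × ℂ) : ev α (sumPow []) = 0 := by simp [sumPow]

lemma X_eq (hα : RootBounds α) : X α = pair α vecX 0 0 := by
  rw [← region_ev hα, X]; congr 1; simp [ev]

lemma Y_eq (hα : RootBounds α) : Y α = pair α vecY 0 0 := by
  rw [← region_ev hα, Y]; congr 1; simp [ev]

lemma image_X (hα : RootBounds α) {φ : ℝ × ℂ → ℝ × ℂ} (e : Vec) (k : ℕ)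
    (h : ∀ z, φ z = ev α e + α ^ k * z) : φ '' X α = (⟨e, k, vecX, 0, 0⟩ : Piece).carrier α := by
  rw [X_eq hα, funext h]; rfl

lemma image_Y (hα : RootBounds α) {φ : ℝ × ℂ → ℝ × ℂ} (e : Vec) (k : ℕ)
    (h : ∀ z, φ z = ev α e + α ^ k * z) : φ '' Y α = (⟨e, k, vecY, 0, 0⟩ : Piece).carrier α := by
  rw [Y_eq hα, funext h]; rfl

/-- The exponents in the translation part, and the exponent of the linear part, of `h α i`. -/
def hExp : Fin 18 → List ℕ × ℕ :=
  ![([4], 4), ([4, 6], 4), ([4, 5], 4), ([4, 5, 6], 4), ([0, 1, 2, 7], 5), ([4, 5], 4),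
    ([4, 7], 4), ([4, 8, 9], 7), ([4], 4), ([4, 5, 7], 4), ([4, 5, 8, 9], 7), ([0, 1, 6, 7], 5),
    ([4, 8], 7), ([4, 8, 9], 7), ([4, 5, 8], 7), ([4, 5, 8, 9], 7), ([0, 1, 6], 5),
    ([0, 1, 6, 7], 5)]

lemma h_apply (hα : RootBounds α) (i : Fin 18) (z : ℝ × ℂ) :
    h α i z = ev α (sumPow (hExp i).1) + α ^ (hExp i).2 * z := by
  fin_cases i <;> simp [h, hExp, ev_sumPow_cons hα, ev_sumPow_nil] <;> ring

def entry (i : Fin 18) (y : Vec) (route : List ℕ)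
    (pts : List (Vec × List ℕ × List ℕ × List ℕ × List ℕ) := []) : Entry :=
  ⟨sumPow (hExp i).1, (hExp i).2, y, route, pts⟩

lemma image_h_X (hα : RootBounds α) (i : Fin 18) :
    h α i '' X α = (⟨sumPow (hExp i).1, (hExp i).2, vecX, 0, 0⟩ : Piece).carrier α :=
  image_X hα _ _ (h_apply hα i)

lemma image_h_Y (hα : RootBounds α) (i : Fin 18) :
    h α i '' Y α = (⟨sumPow (hExp i).1, (hExp i).2, vecY, 0, 0⟩ : Piece).carrier α :=
  image_Y hα _ _ (h_apply hα i)

lemma Icc_zero_four : Set.Icc (0 : Fin 18) 4 = {0, 1, 2, 3, 4} := by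
  ext i
  simp only [Set.mem_Icc, Set.mem_insert_iff, Set.mem_singleton_iff]
  revert i
  decide

lemma Icc_five_eleven : Set.Icc (5 : Fin 18) 11 = {5, 6, 7, 8, 9, 10, 11} := by
  ext i
  simp only [Set.mem_Icc, Set.mem_insert_iff, Set.mem_singleton_iff]
  revert i
  decide

lemma Icc_twelve_seventeen : Set.Icc (12 : Fin 18) 17 = {12, 13, 14, 15, 16, 17} := by
  ext i
  simp only [Set.mem_Icc, Set.mem_insert_iff, Set.mem_singleton_iff]
  revert i
  decide

/-- A quadruple attached to an entry is `1 - α ^ 4` times a point where a branch of the unfolding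
may end. The four lists are the preperiods and periods of the two expansions which place this point
in the piece. -/
def entriesX : List Entry :=
  [entry 0 vecX [2, 0, 0, 1] [((16, 24, 28, 30), [], [1, 1, 0, 0], [0], [1, 0, 1, 0])],
    entry 1 vecX [2, 0, 3, 1], entry 2 vecX [2, 3, 0, 1], entry 3 vecX [2, 3, 3, 1],
    entry 4 vecX [2, 2, 2, 1, 2],
    entry 1 vecY [2, 0, 2, 1] [((-11, -17, -20, -22), [], [1, 1, 0, 0], [], [0, 1, 1, 0])],
    entry 3 vecY [2, 3, 2, 1]]

def entriesY : List Entry :=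
  [entry 5 vecY [2, 3, 1, 0],
    entry 6 vecY [2, 0, 1, 3] [((-36, -55, -65, -70), [], [1, 1, 0, 0], [], [0, 1, 1, 0])],
    entry 7 vecY [2, 0, 1, 1, 2, 2, 1],
    entry 8 vecY [2, 0, 1, 0] [((16, 24, 28, 30), [], [1, 1, 0, 0], [], [0, 1, 1, 0])],
    entry 9 vecY [2, 3, 1, 3] [((-50, -76, -90, -97), [], [1, 1, 0, 0], [], [0, 1, 1, 0])],
    entry 10 vecY [2, 3, 1, 1, 2, 2, 1], entry 11 vecY [2, 2, 1, 1, 2],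
    entry 12 vecX [2, 0, 1, 1, 2, 0, 1]
      [((157, 238, 280, 302), [], [1, 0, 1, 0], [0], [0, 1, 1, 0]),
        ((57, 86, 101, 109), [], [1, 1, 0, 0], [0], [1, 0, 1, 0])],
    entry 13 vecX [2, 0, 1, 1, 2, 3, 1],
    entry 14 vecX [2, 3, 1, 1, 2, 0, 1]
      [((43, 65, 76, 82), [], [1, 1, 0, 0], [0], [1, 0, 1, 0]),
        ((143, 217, 255, 275), [], [1, 0, 1, 0], [0], [0, 1, 1, 0])],
    entry 15 vecX [2, 3, 1, 1, 2, 3, 1], entry 16 vecX [2, 2, 1, 0, 2],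
    entry 17 vecX [2, 2, 1, 3, 2] [((-9, -14, -17, -18), [], [1, 0, 1, 0], [0], [0, 1, 1, 0])]]

theorem X_decomposition (hα : RootBounds α) :
    X α = (⋃ i ∈ Set.Icc (0 : Fin 18) 4, h α i '' X α) ∪ h α 1 '' Y α ∪ h α 3 '' Y α := by
  ext z
  simp only [Icc_zero_four, Set.biUnion_insert, Set.biUnion_singleton, Set.mem_union,
    image_h_X hα, image_h_Y hα]
  rw [X_eq hα, mem_pair_iff_of_decomposition hα (by decide) entriesX (by decide +kernel)]
  simp only [entriesX, entry, Entry.piece, List.mem_cons, List.not_mem_nil, or_false,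
    exists_eq_or_imp, exists_eq_left, or_assoc]

theorem Y_decomposition (hα : RootBounds α) :
    Y α = (⋃ i ∈ Set.Icc (5 : Fin 18) 11, h α i '' Y α) ∪
      ⋃ i ∈ Set.Icc (12 : Fin 18) 17, h α i '' X α := by
  ext z
  simp only [Icc_five_eleven, Icc_twelve_seventeen, Set.biUnion_insert, Set.biUnion_singleton,
    Set.mem_union, image_h_X hα, image_h_Y hα]
  rw [Y_eq hα, mem_pair_iff_of_decomposition hα (by decide) entriesY (by decide +kernel)]
  simp only [entriesY, entry, Entry.piece, List.mem_cons, List.not_mem_nil, or_false,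
    exists_eq_or_imp, exists_eq_left, or_assoc]

def entriesF : List Entry :=
  [⟨sumPow [1], 2, vecX, [0, 2], []⟩, ⟨sumPow [1, 4], 2, vecX, [3, 2], []⟩,
    ⟨sumPow [1, 4], 2, vecY, [1, 2], []⟩]

def entriesG : List Entry :=
  [⟨sumPow [5], 4, vecX, [1, 2, 0, 1],
      [((23, 35, 41, 44), [], [1, 0, 1, 0], [0], [0, 1, 1, 0]),
        ((9, 14, 16, 17), [], [1, 1, 0, 0], [0], [1, 0, 1, 0])]⟩,
    ⟨sumPow [5, 6], 4, vecX, [1, 2, 3, 1], []⟩, ⟨sumPow [5, 6], 4, vecY, [1, 2, 2, 1], []⟩,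
    ⟨sumPow [], 1, vecY, [0], []⟩,
    ⟨sumPow [4], 1, vecY, [3], [((-4, -6, -7, -8), [], [1, 1, 0, 0], [], [0, 1, 1, 0])]⟩]

theorem region_alpha (hα : RootBounds α) :
    region α α = f α 0 '' X α ∪ f α 1 '' X α ∪ f α 1 '' Y α := by
  have e : α = ev α (0, 1, 0, 0) := by simp [ev]
  have h0 : ∀ z, f α 0 z = ev α (sumPow [1]) + α ^ 2 * z := fun z => by
    simp [f, ev_sumPow_cons hα, ev_sumPow_nil]
  have h1 : ∀ z, f α 1 z = ev α (sumPow [1, 4]) + α ^ 2 * z := fun z => by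
    simp [f, ev_sumPow_cons hα, ev_sumPow_nil]
  rw [image_X hα _ _ h0, image_X hα _ _ h1, image_Y hα _ _ h1]
  conv_lhs => arg 2; rw [e]
  ext z
  rw [region_ev hα, mem_pair_iff_of_decomposition hα (by decide) entriesF (by decide +kernel)]
  simp only [entriesF, Entry.piece, List.mem_cons, List.not_mem_nil, or_false, Set.mem_union,
    exists_eq_or_imp, exists_eq_left, or_assoc]

theorem region_alpha_add_sq (hα : RootBounds α) :
    region α (α + α ^ 2) = g α 0 '' X α ∪ g α 1 '' X α ∪ g α 1 '' Y α ∪ g α 2 '' Y α ∪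
      g α 3 '' Y α := by
  have e : α + α ^ 2 = ev α (0, 1, 1, 0) := by simp [ev]
  have h0 : ∀ z, g α 0 z = ev α (sumPow [5]) + α ^ 4 * z := fun z => by
    simp [g, ev_sumPow_cons hα, ev_sumPow_nil]
  have h1 : ∀ z, g α 1 z = ev α (sumPow [5, 6]) + α ^ 4 * z := fun z => by
    simp [g, ev_sumPow_cons hα, ev_sumPow_nil]
  have h2 : ∀ z, g α 2 z = ev α (sumPow []) + α ^ 1 * z := fun z => by
    simp [g, ev_sumPow_nil]
  have h3 : ∀ z, g α 3 z = ev α (sumPow [4]) + α ^ 1 * z := fun z => by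
    simp [g, ev_sumPow_cons hα, ev_sumPow_nil]
  rw [image_X hα _ _ h0, image_X hα _ _ h1, image_Y hα _ _ h1, image_Y hα _ _ h2,
    image_Y hα _ _ h3, e]
  ext z
  rw [region_ev hα, mem_pair_iff_of_decomposition hα (by decide) entriesG (by decide +kernel)]
  simp only [entriesG, Entry.piece, List.mem_cons, List.not_mem_nil, or_false, Set.mem_union,
    exists_eq_or_imp, exists_eq_left, or_assoc]

theorem region_one (hα : RootBounds α) : region α 1 = (fun z => 1 + α * z) '' X α := by
  have e : (1 : ℝ × ℂ) = ev α (1, 0, 0, 0) := by simp [ev]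
  rw [image_X hα (sumPow [0]) 1 (fun z => by simp [ev_sumPow_cons hα, ev_sumPow_nil]), e]
  ext z
  rw [region_ev hα, mem_pair_iff_of_decomposition hα (by decide)
    [⟨sumPow [0], 1, vecX, [2], []⟩] (by decide +kernel)]
  simp only [Entry.piece, List.mem_singleton, exists_eq_left]

lemma one_div_mul (hα : RootBounds α) : 1 / α * α = 1 := by
  obtain ⟨γ, hγ⟩ := exists_inverse hα
  have h1 : α.1 ≠ 0 := fun h0 => by simpa [h0] using congrArg Prod.fst hγ
  have h2 : α.2 ≠ 0 := fun h0 => by simpa [h0] using congrArg Prod.snd hγ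
  ext1
  · simp [h1]
  · simp [h2]

theorem region_sq (hα : RootBounds α) :
    region α (α ^ 2) = (fun z => -(1 / α) - 1 - α + z / α) '' X α := by
  have e : α ^ 2 = ev α (0, 0, 1, 0) := by simp [ev]
  -- The only first step from `1 + α + α ^ 2` has digits `1, 0` and leads to `α ^ 2`; the stated
  -- formula is this relation inverted.
  have hX : X α = (fun w => 1 + α + α ^ 2 + α * w) '' region α (α ^ 2) := by
    have hr := region_ev hα (0, 0, 1, 0)
    rw [← e] at hr
    rw [hr]
    ext z
    rw [X_eq hα, mem_pair_iff_of_decomposition hα (by decide)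
      [⟨sumPow [0, 1, 2], 1, (0, 0, 1, 0), [2], []⟩] (by decide +kernel)]
    simp only [Entry.piece, Piece.carrier, ev_sumPow_cons hα, ev_sumPow_nil, List.mem_singleton,
      exists_eq_left, pow_zero, pow_one, add_zero, add_assoc]
  rw [hX, Set.image_image]
  conv_lhs => rw [← Set.image_id' (region α (α ^ 2))]
  refine Set.image_congr fun w _ => ?_
  have h1 := one_div_mul hα
  rw [div_eq_mul_one_div (1 + α + α ^ 2 + α * w) α]
  linear_combination (-1 - α - w) * h1

end Decomposition
end Tetranacci
end

/-! ### One-point regions, counting, and compactness -/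

noncomputable section
namespace Tetranacci

section Points
variable {α : ℝ × ℂ}

lemma div_one_sub_eq (hα : RootBounds α) {k : ℕ} (hk : k ≠ 0) {z w : ℝ × ℂ}
    (h : (1 - α ^ k) * z = w) : w / (1 - α ^ k) = z := by
  obtain ⟨γ, hγ⟩ := exists_inverse_one_sub hα hk
  have h1 : (1 - α ^ k).1 ≠ 0 := fun h0 => by
    have := congrArg Prod.fst hγ
    rw [Prod.fst_mul, h0] at this
    simp at this
  have h2 : (1 - α ^ k).2 ≠ 0 := fun h0 => by
    have := congrArg Prod.snd hγ
    rw [Prod.snd_mul, h0] at this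
    simp at this
  rw [← h]
  ext1
  · rw [Prod.fst_div, Prod.fst_mul, mul_div_cancel_left₀ _ h1]
  · rw [Prod.snd_div, Prod.snd_mul, mul_div_cancel_left₀ _ h2]

lemma mul_div_one_sub (hα : RootBounds α) {k : ℕ} (hk : k ≠ 0) (w : ℝ × ℂ) :
    (1 - α ^ k) * (w / (1 - α ^ k)) = w := by
  obtain ⟨γ, hγ⟩ := exists_inverse_one_sub hα hk
  have h1 : (1 - α ^ k) * (γ * w) = w := by rw [← mul_assoc, hγ, one_mul]
  rw [div_one_sub_eq hα hk h1, h1]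

lemma pair_eq_singleton (hα : RootBounds α) (t : Vec × Vec) (ht : t ∈ points)
    (a b a' b' : List ℕ)
    (h : periodicPair t.2 t.1 0 0 (bits a) (bits b) (bits a') (bits b') = true) {c : ℝ × ℂ}
    (hc : (1 - α ^ 4) * c = ev α t.2) : pair α t.1 0 0 = {c} := by
  ext z
  rw [Set.mem_singleton_iff]
  constructor
  · intro hz
    exact mul_left_cancel_one_sub hα (k := 4) (by norm_num)
      ((eq_of_mem_points hα t ht z hz).trans hc.symm)
  · rintro rfl
    exact mem_pair_of_periodic hα h hc

theorem region_one_add_sq (hα : RootBounds α) :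
    region α (1 + α ^ 2) = {α ^ 4 / (1 - α ^ 2)} := by
  have e : 1 + α ^ 2 = ev α (1, 0, 1, 0) := by simp [ev]
  have h2 := mul_div_one_sub hα (k := 2) (by norm_num) (α ^ 4)
  rw [e, region_ev hα]
  refine pair_eq_singleton hα ((1, 0, 1, 0), (3, 4, 5, 5)) (by decide) [] [1, 0, 1, 0] [0]
    [1, 0, 1, 0] (by decide +kernel) ?_
  rw [show ((3, 4, 5, 5) : Vec) = sumPow [4, 6] by decide +kernel, ev_sumPow_cons hα,
    ev_sumPow_cons hα, ev_sumPow_nil]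
  -- The period `10` is read twice: `α ^ 4 / (1 - α ^ 2) = (α ^ 4 + α ^ 6) / (1 - α ^ 4)`.
  linear_combination (1 + α ^ 2) * h2

lemma inv_pow_eq {n : ℕ} (hn : n ≠ 0) {z : ℝ × ℂ} (h : α ^ n * z = 1) :
    α ^ (-(n : ℤ)) = z := by
  have h1 : α.1 ≠ 0 := fun h0 => by
    have := congrArg Prod.fst h
    rw [Prod.fst_mul, Prod.pow_fst, h0] at this
    simp [hn] at this
  have h2 : α.2 ≠ 0 := fun h0 => by
    have := congrArg Prod.snd h
    rw [Prod.snd_mul, Prod.pow_snd, h0] at this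
    simp [hn] at this
  rw [zpow_neg, zpow_natCast]
  ext1
  · have := congrArg Prod.fst h
    exact inv_eq_of_mul_eq_one_right this
  · have := congrArg Prod.snd h
    exact inv_eq_of_mul_eq_one_right this

lemma zpow_eq (hα : RootBounds α) (n : ℕ) (hn : n ≠ 0) :
    α ^ (-(n : ℤ)) = ev α (down^[n] (1, 0, 0, 0)) :=
  inv_pow_eq hn (by rw [mul_ev_down_iterate hα]; simp [ev])

/-- Dividing the equation of `α` by `α ^ 2` gives `α ^ 2 = α + 1 + α⁻¹ + α⁻²`, so this index lies in
the lattice spanned by `1, α, α ^ 2`. -/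
lemma shift_eq_sq_sub_one (hα : RootBounds α) :
    α ^ (-2 : ℤ) + α ^ (-1 : ℤ) + α = ev α (-1, 0, 1, 0) := by
  have h2 := zpow_eq hα 2 (by norm_num)
  have h1 := zpow_eq hα 1 (by norm_num)
  have e : α = ev α (0, 1, 0, 0) := by simp [ev]
  norm_cast at h1 h2 ⊢
  rw [h1, h2]
  conv_lhs => rw [show ∀ x y : ℝ × ℂ, x + y + α = x + y + ev α (0, 1, 0, 0) by simp [ev]]
  rw [← ev_add, ← ev_add]
  congr 1

lemma shift_eq_one_two_one (hα : RootBounds α) :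
    α ^ (-3 : ℤ) + α ^ (-2 : ℤ) + 1 + α ^ 3 = ev α (1, 2, 1, 0) := by
  have h2 := zpow_eq hα 2 (by norm_num)
  have h1 := zpow_eq hα 3 (by norm_num)
  norm_cast at h1 h2 ⊢
  rw [h1, h2]
  conv_lhs => rw [show ∀ x y : ℝ × ℂ, x + y + 1 + α ^ 3 =
    x + y + ev α (1, 0, 0, 0) + ev α (0, 0, 0, 1) by simp [ev]]
  rw [← ev_add, ← ev_add, ← ev_add]
  congr 1

theorem region_sq_sub_one (hα : RootBounds α) :
    region α (α ^ (-2 : ℤ) + α ^ (-1 : ℤ) + α) = {(α ^ 5 + α ^ 6) / (1 - α ^ 4)} := by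
  rw [shift_eq_sq_sub_one hα, region_ev hα]
  refine pair_eq_singleton hα ((-1, 0, 1, 0), (3, 5, 6, 6)) (by decide) [] [0, 1, 1, 0] [1, 0]
    [0, 1, 1, 0] (by decide +kernel) ?_
  rw [show ((3, 5, 6, 6) : Vec) = sumPow [5, 6] by decide +kernel, ev_sumPow_cons hα,
    ev_sumPow_cons hα, ev_sumPow_nil, mul_div_one_sub hα (by norm_num), add_zero]

theorem region_one_two_one (hα : RootBounds α) :
    region α (α ^ (-3 : ℤ) + α ^ (-2 : ℤ) + 1 + α ^ 3) = {(α ^ 4 + α ^ 5) / (1 - α ^ 4)} := by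
  rw [shift_eq_one_two_one hα, region_ev hα]
  refine pair_eq_singleton hα ((1, 2, 1, 0), (2, 3, 3, 3)) (by decide) [] [1, 1, 0, 0] [0]
    [0, 1, 1, 0] (by decide +kernel) ?_
  rw [show ((2, 3, 3, 3) : Vec) = sumPow [4, 5] by decide +kernel, ev_sumPow_cons hα,
    ev_sumPow_cons hα, ev_sumPow_nil, mul_div_one_sub hα (by norm_num), add_zero]

theorem region_neg (α u : ℝ × ℂ) : region α (-u) = (fun z => z - u) '' region α u := by
  ext z
  simp only [region, Set.mem_inter_iff, Set.mem_image]
  constructor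
  · rintro ⟨h1, w, h2, rfl⟩
    exact ⟨w, ⟨h2, w + -u, h1, by ring⟩, by ring⟩
  · rintro ⟨w, ⟨h1, w', h2, rfl⟩, rfl⟩
    exact ⟨by simpa using h2, w' + u, h1, by ring⟩

/-- The coordinates of the shifts. -/
def halfVecs : Finset Vec :=
  {(1, 0, 0, 0), (1, 1, 0, 0), (1, 0, 1, 0), (1, 1, 1, 0), (1, 2, 1, 0), (0, 1, 0, 0),
    (0, 1, 1, 0), (0, 0, 1, 0), (-1, 0, 1, 0)}

def halfPointVecs : Finset Vec := {(1, 0, 1, 0), (-1, 0, 1, 0), (1, 2, 1, 0)}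

lemma halfShifts_eq (hα : RootBounds α) : halfShifts α = ev α '' halfVecs := by
  simp only [halfShifts, shift_eq_sq_sub_one hα, shift_eq_one_two_one hα, halfVecs,
    Finset.coe_insert, Finset.coe_singleton, Set.image_insert_eq, Set.image_singleton]
  simp [ev]

lemma halfPointShifts_eq (hα : RootBounds α) : halfPointShifts α = ev α '' halfPointVecs := by
  simp only [halfPointShifts, shift_eq_sq_sub_one hα, shift_eq_one_two_one hα, halfPointVecs,
    Finset.coe_insert, Finset.coe_singleton, Set.image_insert_eq, Set.image_singleton]
  simp [ev]

lemma neg_image_ev (s : Finset Vec) : -(ev α '' s) = ev α '' (s.image (-·) : Finset Vec) := by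
  ext z
  rw [Finset.coe_image]
  constructor
  · rintro ⟨x, hx, h⟩
    exact ⟨-x, ⟨x, hx, rfl⟩, by rw [ev_neg, h, neg_neg]⟩
  · rintro ⟨_, ⟨x, hx, rfl⟩, rfl⟩
    exact ⟨x, hx, by rw [ev_neg, neg_neg]⟩

lemma shifts_eq (hα : RootBounds α) :
    shifts α = ev α '' (halfVecs ∪ halfVecs.image (-·) : Finset Vec) := by
  rw [shifts, halfShifts_eq hα, neg_image_ev, Finset.coe_union, Set.image_union]

lemma pointShifts_eq (hα : RootBounds α) :
    pointShifts α = ev α '' (halfPointVecs ∪ halfPointVecs.image (-·) : Finset Vec) := by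
  rw [pointShifts, halfPointShifts_eq hα, neg_image_ev, Finset.coe_union, Set.image_union]

lemma realEv_injective (hα : RootBounds α) {a b c : ℝ} (h : realEv α a b c 0 = 0) :
    a = 0 ∧ b = 0 ∧ c = 0 := by
  obtain ⟨h1, h2, h3⟩ := coord_bounds hα (a := a) (b := b) (c := c) (B := 0)
    (by simp [h]) (by simp [h]) (by simp [h])
  rw [mul_zero] at h1 h2 h3
  exact ⟨abs_nonpos_iff.1 h1, abs_nonpos_iff.1 h2, abs_nonpos_iff.1 h3⟩

/-- `1, α, α ^ 2` are linearly independent over `ℝ`, so shifts can be counted by their coordinates.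
-/
lemma ev_injOn (hα : RootBounds α) : Set.InjOn (ev α) {x | x.2.2.2 = 0} := by
  rintro ⟨a, b, c, d⟩ hd ⟨a', b', c', d'⟩ hd' h
  simp only [Set.mem_ofPred_eq] at hd hd'
  subst hd hd'
  have h1 : ev α ((a, b, c, 0) - (a', b', c', 0)) = 0 := by rw [ev_sub, h, sub_self]
  rw [ev_eq_realEv] at h1
  obtain ⟨e1, e2, e3⟩ := realEv_injective hα (by simpa using h1)
  simp only [Prod.mk.injEq, and_true]
  refine ⟨?_, ?_, ?_⟩
  · exact_mod_cast sub_eq_zero.1 e1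
  · exact_mod_cast sub_eq_zero.1 e2
  · exact_mod_cast sub_eq_zero.1 e3

lemma ncard_image_ev (hα : RootBounds α) (s : Finset Vec) (hs : ∀ x ∈ s, x.2.2.2 = 0) :
    (ev α '' s).ncard = s.card := by
  rw [((ev_injOn hα).mono hs).ncard_image, Set.ncard_coe_finset]

theorem ncard_shifts (hα : RootBounds α) : (shifts α).ncard = 18 := by
  rw [shifts_eq hα, ncard_image_ev hα _ (by decide +kernel)]
  decide +kernel

theorem ncard_pointShifts (hα : RootBounds α) : (pointShifts α).ncard = 6 := by
  rw [pointShifts_eq hα, ncard_image_ev hα _ (by decide +kernel)]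
  decide +kernel

lemma X_nonempty (hα : RootBounds α) : (X α).Nonempty := by
  rw [X_eq hα]
  -- The point `α ^ 4 / (1 - α ^ 4)`, equal to `1 + α + α ^ 2 + α ^ 7 / (1 - α ^ 4)`.
  exact ⟨_, mem_pair_of_periodic hα (v := (1, 1, 1, 1)) (a := bits []) (b := bits [1, 0, 0, 0])
    (a' := bits [0]) (b' := bits [0, 0, 1, 0]) (by decide +kernel)
    (mul_div_one_sub hα (k := 4) (by norm_num) _)⟩

lemma pow_ne_zero' (hα : RootBounds α) (n : ℕ) : α ^ n ≠ 0 := fun h0 => by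
  have := mul_left_cancel_pow hα n (z := 1) (w := 0) (by simp [h0])
  exact one_ne_zero this

/-- Two of the pieces of `X` are translates of each other by `α ^ 6 ≠ 0`. The same works for `Y`
with `α ^ 9`. -/
lemma X_nontrivial (hα : RootBounds α) : (X α).Nontrivial := by
  obtain ⟨z, hz⟩ := X_nonempty hα
  have h0 : h α 0 z ∈ X α := by
    rw [X_decomposition hα]
    exact Or.inl (Or.inl (Set.mem_biUnion (by decide) ⟨z, hz, rfl⟩))
  have h1 : h α 1 z ∈ X α := by
    rw [X_decomposition hα]
    exact Or.inl (Or.inl (Set.mem_biUnion (by decide) ⟨z, hz, rfl⟩))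
  refine ⟨_, h0, _, h1, fun he => pow_ne_zero' hα 6 ?_⟩
  simp only [h_apply hα, hExp, Matrix.cons_val_zero, Matrix.cons_val_one, ev_sumPow_cons hα,
    ev_sumPow_nil] at he
  linear_combination -he

lemma Y_nontrivial (hα : RootBounds α) : (Y α).Nontrivial := by
  obtain ⟨z, hz⟩ := X_nonempty hα
  have h0 : h α 12 z ∈ Y α := by
    rw [Y_decomposition hα]
    exact Or.inr (Set.mem_biUnion (by decide) ⟨z, hz, rfl⟩)
  have h1 : h α 13 z ∈ Y α := by
    rw [Y_decomposition hα]
    exact Or.inr (Set.mem_biUnion (by decide) ⟨z, hz, rfl⟩)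
  refine ⟨_, h0, _, h1, fun he => pow_ne_zero' hα 9 ?_⟩
  have e1 : hExp 12 = ([4, 8], 7) := rfl
  have e2 : hExp 13 = ([4, 8, 9], 7) := rfl
  simp only [h_apply hα, e1, e2, ev_sumPow_cons hα, ev_sumPow_nil] at he
  linear_combination -he

lemma affine_injective (hα : RootBounds α) (e : ℝ × ℂ) (k : ℕ) :
    Function.Injective fun z => e + α ^ k * z :=
  fun _ _ h => mul_left_cancel_pow hα k (add_left_cancel h)

lemma image_X_nontrivial (hα : RootBounds α) (e : ℝ × ℂ) (k : ℕ) {φ : ℝ × ℂ → ℝ × ℂ}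
    (h : ∀ z, φ z = e + α ^ k * z) : (φ '' X α).Nontrivial := by
  rw [funext h]
  exact (X_nontrivial hα).image (affine_injective hα e k)

lemma region_neg_nontrivial {u : ℝ × ℂ} (h : (region α u).Nontrivial) :
    (region α (-u)).Nontrivial := by
  rw [region_neg]
  exact h.image sub_left_injective

lemma region_half (hα : RootBounds α) {x : Vec} (hx : x ∈ halfVecs) :
    (x ∈ halfPointVecs ∧ ∃ z, region α (ev α x) = {z}) ∨
      (x ∉ halfPointVecs ∧ -x ∉ halfPointVecs ∧ (region α (ev α x)).Nontrivial) := by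
  simp only [halfVecs, Finset.mem_insert, Finset.mem_singleton] at hx
  rcases hx with rfl | rfl | rfl | rfl | rfl | rfl | rfl | rfl | rfl
  · refine Or.inr ⟨by decide, by decide, ?_⟩
    rw [show ev α (1, 0, 0, 0) = 1 by simp [ev], region_one hα]
    exact image_X_nontrivial hα 1 1 (fun z => by rw [pow_one])
  · refine Or.inr ⟨by decide, by decide, ?_⟩
    rw [show ev α (1, 1, 0, 0) = 1 + α by simp [ev]]
    exact Y_nontrivial hα
  · refine Or.inl ⟨by decide, α ^ 4 / (1 - α ^ 2), ?_⟩
    rw [show ev α (1, 0, 1, 0) = 1 + α ^ 2 by simp [ev]]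
    exact region_one_add_sq hα
  · refine Or.inr ⟨by decide, by decide, ?_⟩
    rw [show ev α (1, 1, 1, 0) = 1 + α + α ^ 2 by simp [ev]]
    exact X_nontrivial hα
  · refine Or.inl ⟨by decide, (α ^ 4 + α ^ 5) / (1 - α ^ 4), ?_⟩
    rw [← shift_eq_one_two_one hα]
    exact region_one_two_one hα
  · refine Or.inr ⟨by decide, by decide, ?_⟩
    rw [show ev α (0, 1, 0, 0) = α by simp [ev], region_alpha hα]
    exact (image_X_nontrivial hα α 2 (fun z => rfl)).mono fun z hz => Or.inl (Or.inl hz)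
  · refine Or.inr ⟨by decide, by decide, ?_⟩
    rw [show ev α (0, 1, 1, 0) = α + α ^ 2 by simp [ev], region_alpha_add_sq hα]
    exact (image_X_nontrivial hα (α ^ 5) 4 (fun z => rfl)).mono
      fun z hz => Or.inl (Or.inl (Or.inl (Or.inl hz)))
  · refine Or.inr ⟨by decide, by decide, ?_⟩
    rw [show ev α (0, 0, 1, 0) = α ^ 2 by simp [ev], region_sq hα]
    refine (X_nontrivial hα).image fun z w hzw => ?_
    have h1 := one_div_mul hα
    have h2 : z / α = w / α := by simpa using hzw
    rw [div_eq_mul_one_div z, div_eq_mul_one_div w] at h2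
    linear_combination α * h2 - (z - w) * h1
  · refine Or.inl ⟨by decide, (α ^ 5 + α ^ 6) / (1 - α ^ 4), ?_⟩
    rw [← shift_eq_sq_sub_one hα]
    exact region_sq_sub_one hα

lemma region_vec (hα : RootBounds α) {x : Vec} (hx : x ∈ halfVecs ∪ halfVecs.image (-·)) :
    (x ∈ halfPointVecs ∪ halfPointVecs.image (-·) ∧ ∃ z, region α (ev α x) = {z}) ∨
      (x ∉ halfPointVecs ∪ halfPointVecs.image (-·) ∧ (region α (ev α x)).Nontrivial) := by
  have hneg : ∀ y : Vec, y ∈ halfPointVecs.image (-·) ↔ -y ∈ halfPointVecs := fun y => by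
    simp [Finset.mem_image, neg_eq_iff_eq_neg]
  simp only [Finset.mem_union, hneg]
  rcases Finset.mem_union.1 hx with hx | hx
  · rcases region_half hα hx with ⟨h1, h2⟩ | ⟨h1, h2, h3⟩
    · exact Or.inl ⟨Or.inl h1, h2⟩
    · exact Or.inr ⟨by tauto, h3⟩
  · obtain ⟨y, hy, rfl⟩ := Finset.mem_image.1 hx
    rw [neg_neg, ev_neg]
    rcases region_half hα hy with ⟨h1, z, h2⟩ | ⟨h1, h2, h3⟩
    · exact Or.inl ⟨Or.inr h1, z - ev α y, by rw [region_neg, h2, Set.image_singleton]⟩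
    · exact Or.inr ⟨by tauto, region_neg_nontrivial h3⟩

theorem region_nonempty (hα : RootBounds α) : ∀ u ∈ shifts α, (region α u).Nonempty := by
  rw [shifts_eq hα]
  rintro _ ⟨x, hx, rfl⟩
  rcases region_vec hα hx with ⟨-, z, h⟩ | ⟨-, h⟩
  · rw [h]; exact Set.singleton_nonempty z
  · exact h.nonempty

theorem singleton_shifts (hα : RootBounds α) :
    {u ∈ shifts α | ∃ z, region α u = {z}} = pointShifts α := by
  rw [shifts_eq hα, pointShifts_eq hα]
  ext u
  constructor
  · rintro ⟨⟨x, hx, rfl⟩, z, hz⟩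
    rcases region_vec hα hx with ⟨h1, -⟩ | ⟨-, h⟩
    · exact ⟨x, h1, rfl⟩
    · rw [hz] at h
      exact absurd h (by simp)
  · rintro ⟨x, hx, rfl⟩
    have hsub : halfPointVecs ∪ halfPointVecs.image (-·) ⊆ halfVecs ∪ halfVecs.image (-·) := by
      decide +kernel
    refine ⟨⟨x, hsub hx, rfl⟩, ?_⟩
    rcases region_vec hα (hsub hx) with ⟨-, h⟩ | ⟨h, -⟩
    · exact h
    · exact absurd hx h

theorem isCompact_region (hα : RootBounds α) (u : ℝ × ℂ) : IsCompact (region α u) := by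
  rw [region, fractal_eq_tile hα]
  exact (isCompact_tile hα 0).inter
    ((isCompact_tile hα 0).image (continuous_id.add continuous_const))

end Points
end Tetranacci
end

/-! ### The covering by lattice translates and the boundary -/

noncomputable section
namespace Tetranacci

section Frontier
variable {α : ℝ × ℂ}

def latticeVec (g : ℤ × ℤ × ℤ) : Vec := (g.1, g.2.1, g.2.2, 0)

/-- The translates of the fractal by the lattice generated by `1, α, α²`. -/
def cell (α : ℝ × ℂ) (g : ℤ × ℤ × ℤ) : Set (ℝ × ℂ) :=
  (fun z => z + ev α (latticeVec g)) '' tile α 0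

lemma isClosed_cell (hα : RootBounds α) (g : ℤ × ℤ × ℤ) : IsClosed (cell α g) :=
  ((isCompact_tile hα 0).image (continuous_id.add continuous_const)).isClosed

lemma norm_component_le (z : ℝ × ℂ) : |z.1| ≤ ‖z‖ ∧ |z.2.re| ≤ ‖z‖ ∧ |z.2.im| ≤ ‖z‖ :=
  ⟨norm_fst_le z, (Complex.abs_re_le_norm _).trans (norm_snd_le z),
    (Complex.abs_im_le_norm _).trans (norm_snd_le z)⟩

lemma locallyFinite_cell (hα : RootBounds α) : LocallyFinite (cell α) := by
  obtain ⟨C, hC⟩ := (isCompact_tile hα 0).isBounded.exists_norm_le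
  intro x
  refine ⟨Metric.ball x 1, Metric.ball_mem_nhds x one_pos, ?_⟩
  set B := ‖x‖ + 1 + C
  set N := ⌈5 * B⌉
  refine (Set.finite_Icc ((-N, -N, -N) : ℤ × ℤ × ℤ) (N, N, N)).subset ?_
  rintro ⟨a, b, c⟩ ⟨_, ⟨z, hz, rfl⟩, hball⟩
  rw [mem_ball_iff_norm] at hball
  have h1 : ‖ev α (latticeVec (a, b, c))‖ ≤ B := by
    have e : ev α (latticeVec (a, b, c)) =
        (z + ev α (latticeVec (a, b, c)) - x) + x - z := by ring
    rw [e]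
    have t1 := norm_sub_le ((z + ev α (latticeVec (a, b, c)) - x) + x) z
    have t2 := norm_add_le (z + ev α (latticeVec (a, b, c)) - x) x
    have t3 := hC z hz
    simp only [B]
    linarith
  rw [ev_eq_realEv] at h1
  simp only [latticeVec, Int.cast_zero] at h1
  obtain ⟨n1, n2, n3⟩ := norm_component_le (realEv α a b c 0)
  obtain ⟨k1, k2, k3⟩ := coord_bounds hα (n1.trans h1) (n2.trans h1) (n3.trans h1)
  have key : ∀ m : ℤ, |(m : ℝ)| ≤ 5 * B → -N ≤ m ∧ m ≤ N := fun m hm => by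
    have : ((|m| : ℤ) : ℝ) ≤ N := by
      rw [Int.cast_abs]; exact hm.trans (Int.le_ceil _)
    exact abs_le.1 (by exact_mod_cast this)
  exact ⟨⟨(key a k1).1, (key b k2).1, (key c k3).1⟩, ⟨(key a k1).2, (key b k2).2, (key c k3).2⟩⟩

lemma exists_realEv_eq (hα : RootBounds α) (z : ℝ × ℂ) : ∃ a b c, realEv α a b c 0 = z := by
  let L : (ℝ × ℝ × ℝ) →ₗ[ℝ] ℝ × ℂ :=
    { toFun := fun x => realEv α x.1 x.2.1 x.2.2 0
      map_add' := fun x y => by simp only [realEv, Prod.fst_add, Prod.snd_add]; module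
      map_smul' := fun t x => by
        simp only [realEv, Prod.smul_fst, Prod.smul_snd, smul_eq_mul, RingHom.id_apply]; module }
  have hinj : Function.Injective L := by
    rw [← LinearMap.ker_eq_bot, LinearMap.ker_eq_bot']
    rintro ⟨a, b, c⟩ h
    obtain ⟨rfl, rfl, rfl⟩ := realEv_injective hα h
    rfl
  have hdim : Module.finrank ℝ (ℝ × ℝ × ℝ) = Module.finrank ℝ (ℝ × ℂ) := by
    simp [Module.finrank_prod, Complex.finrank_real_complex]
  obtain ⟨⟨a, b, c⟩, h⟩ :=
    (LinearMap.injective_iff_surjective_of_finrank_eq_finrank hdim).1 hinj z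
  exact ⟨a, b, c, h⟩

lemma exists_norm_sub_ev_le (hα : RootBounds α) (z : ℝ × ℂ) :
    ∃ x, ‖z - ev α x‖ ≤ ‖(1 : ℝ × ℂ)‖ + ‖α‖ + ‖α ^ 2‖ := by
  obtain ⟨a, b, c, rfl⟩ := exists_realEv_eq hα z
  refine ⟨(⌊a⌋, ⌊b⌋, ⌊c⌋, 0), ?_⟩
  have e : realEv α a b c 0 - ev α (⌊a⌋, ⌊b⌋, ⌊c⌋, 0) =
      Int.fract a • 1 + Int.fract b • α + Int.fract c • α ^ 2 := by
    rw [ev_eq_realEv]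
    simp only [realEv, Int.fract, Int.cast_zero]
    module
  rw [e]
  have key : ∀ (t : ℝ) (w : ℝ × ℂ), ‖Int.fract t • w‖ ≤ ‖w‖ := fun t w => by
    rw [norm_smul, Real.norm_of_nonneg (Int.fract_nonneg t)]
    exact mul_le_of_le_one_left (norm_nonneg _) (Int.fract_lt_one t).le
  exact (norm_add₃_le).trans (by gcongr <;> exact key _ _)

/-- `ℤ[α]` is dense: it contains a lattice of full rank and is stable under the contraction by `α`.
-/
lemma exists_norm_sub_ev_lt (hα : RootBounds α) (z : ℝ × ℂ) {ε : ℝ} (hε : 0 < ε) :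
    ∃ x, ‖z - ev α x‖ < ε := by
  have h1 := (tendsto_pow_atTop_nhds_zero_of_lt_one (norm_nonneg α) (norm_lt_one hα)).mul_const
    (‖(1 : ℝ × ℂ)‖ + ‖α‖ + ‖α ^ 2‖)
  rw [zero_mul] at h1
  obtain ⟨n, hn⟩ := (h1.eventually (gt_mem_nhds hε)).exists
  obtain ⟨w, rfl⟩ := exists_pow_mul_eq hα n z
  obtain ⟨x, hx⟩ := exists_norm_sub_ev_le hα w
  refine ⟨up^[n] x, lt_of_le_of_lt ?_ hn⟩
  rw [ev_up_iterate hα, ← mul_sub]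
  refine (norm_mul_le _ _).trans ?_
  gcongr
  rcases Nat.eq_zero_or_pos n with rfl | h0
  · simp
  · exact norm_pow_le' α h0

lemma powVec_succ (n : ℕ) : powVec (n + 1) = up (powVec n) := by
  rw [powVec, Function.iterate_succ_apply']; rfl

/-- The Tetranacci numbers. -/
def coeff (n : ℕ) : ℤ := (powVec n).2.2.2

lemma coeff_add_four (n : ℕ) :
    coeff (n + 4) = coeff (n + 3) + coeff (n + 2) + coeff (n + 1) + coeff n := by
  simp only [coeff, powVec_succ, up]; ring

lemma coeff_nonneg_and_pos : ∀ n, 0 ≤ coeff n ∧ 1 ≤ coeff (n + 3)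
  | 0 => by decide
  | 1 => by decide
  | 2 => by decide
  | 3 => by decide
  | n + 4 => by
    have h0 := coeff_nonneg_and_pos n
    have h1 := coeff_nonneg_and_pos (n + 1)
    have h2 := coeff_nonneg_and_pos (n + 2)
    have h3 := coeff_nonneg_and_pos (n + 3)
    have e := coeff_add_four n
    have e' := coeff_add_four (n + 3)
    have e1 : coeff (n + 3 + 1) = coeff (n + 1 + 3) := rfl
    exact ⟨by omega, by
      change 1 ≤ coeff (n + 3 + 4)
      have := coeff_nonneg_and_pos (n + 1)
      simp only [show n + 3 + 3 = n + 6 by rfl, show n + 3 + 2 = n + 5 by rfl,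
        show n + 3 + 1 = n + 4 by rfl] at *
      omega⟩

lemma lt_coeff : ∀ k : ℕ, (k : ℤ) < coeff (k + 4)
  | 0 => by decide
  | k + 1 => by
    have h := lt_coeff k
    have h1 := (coeff_nonneg_and_pos k).2
    have h2 := (coeff_nonneg_and_pos (k + 2)).1
    have h3 := (coeff_nonneg_and_pos (k + 1)).1
    have e := coeff_add_four (k + 1)
    simp only [show k + 1 + 3 = k + 4 by rfl, show k + 1 + 2 = k + 3 by rfl,
      show k + 1 + 1 = k + 2 by rfl] at e
    push_cast
    omega

/-- Greedy expansions with respect to the Tetranacci numbers. -/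
lemma exists_expansion (k : ℕ) : ∀ N : ℤ, 0 ≤ N → N < coeff (k + 4) →
    ∃ δ : ℕ → Bool, NoFour 0 δ ∧ (∀ i, k ≤ i → δ i = false) ∧
      ∑ i ∈ Finset.range k, (if δ i then coeff (i + 4) else 0) = N := by
  induction k with
  | zero =>
    intro N h0 h1
    have : coeff (0 + 4) = 1 := by decide
    exact ⟨fun _ => false, ⟨⟨0, by omega, rfl⟩, fun _ => ⟨0, by omega, rfl⟩⟩, fun _ _ => rfl, by
      simp; omega⟩
  | succ k ih =>
    intro N h0 h1
    by_cases hN : N < coeff (k + 4)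
    · obtain ⟨δ, hδ, hk, hs⟩ := ih N h0 hN
      refine ⟨δ, hδ, fun i hi => hk i (by omega), ?_⟩
      rw [Finset.sum_range_succ, hs, hk k le_rfl]
      simp
    · have e := coeff_add_four (k + 1)
      have e' := coeff_add_four k
      have hc := (coeff_nonneg_and_pos k).1
      simp only [show k + 1 + 3 = k + 4 by rfl, show k + 1 + 2 = k + 3 by rfl,
        show k + 1 + 1 = k + 2 by rfl] at e
      -- The remainder is below `coeff (k + 4)` because `coeff (k + 5) = 2 * coeff (k + 4) - coeff
      -- k`.
      obtain ⟨δ, hδ, hk, hs⟩ := ih (N - coeff (k + 4)) (by omega) (by omega)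
      have hne : ∀ i, i ≠ k → Function.update δ k true i = δ i :=
        fun i hi => Function.update_of_ne hi _ _
      have hfour : ∀ n, ∃ i < 4, Function.update δ k true (n + i) = false := by
        intro n
        by_contra! hcon
        have ht : ∀ i < 4, Function.update δ k true (n + i) = true := fun i hi => by
          simpa using hcon i hi
        rcases lt_trichotomy (n + 3) k with h | h | h
        · obtain ⟨i, hi, hi'⟩ := hδ.2 n
          have := ht i hi
          rw [hne _ (by omega), hi'] at this
          cases this
        -- Three digits `1` just below the new one would give `N ≥ coeff (k + 5)`, by the
        -- recurrence.
        · subst h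
          have t0 := ht 0 (by omega)
          have t1 := ht 1 (by omega)
          have t2 := ht 2 (by omega)
          rw [hne _ (by omega)] at t0 t1 t2
          rw [Finset.sum_range_succ, Finset.sum_range_succ, Finset.sum_range_succ, t2, t1,
            show δ n = true from t0] at hs
          have hnn : 0 ≤ ∑ i ∈ Finset.range n, (if δ i then coeff (i + 4) else 0) :=
            Finset.sum_nonneg fun i _ => by
              split_ifs
              · exact (coeff_nonneg_and_pos _).1
              · exact le_rfl
          simp only [if_true] at hs
          simp only [show n + 3 + 1 = n + 4 by rfl, show n + 3 + 2 = n + 5 by rfl,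
            show n + 3 + 3 = n + 6 by rfl] at *
          omega
        · have := ht 3 (by omega)
          rw [hne _ (by omega), hk _ (by omega)] at this
          cases this
      refine ⟨Function.update δ k true, ⟨by simpa using hfour 0, hfour⟩, fun i hi => ?_, ?_⟩
      · rw [hne _ (by omega), hk _ (by omega)]
      · rw [Finset.sum_range_succ, Function.update_self, if_pos rfl,
          Finset.sum_congr rfl fun i hi => by rw [hne i (Finset.mem_range.1 hi).ne], hs]
        ring

lemma val_eq_ev (hα : RootBounds α) {δ : ℕ → Bool} {k : ℕ} (hk : ∀ i, k ≤ i → δ i = false) :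
    val α δ = ev α (∑ i ∈ Finset.range k, if δ i then powVec (i + 4) else 0) := by
  rw [val, tsum_eq_sum (s := Finset.range k) fun i hi => by
    rw [Finset.mem_range, not_lt] at hi
    simp [term, hk i hi]]
  have := map_sum (AddMonoidHom.mk' (ev α) (ev_add α))
    (fun i => if δ i then powVec (i + 4) else 0) (Finset.range k)
  simp only [AddMonoidHom.mk'_apply] at this
  rw [this]
  refine Finset.sum_congr rfl fun i _ => ?_
  unfold term
  split_ifs
  · rw [ev_powVec hα]
  · rw [ev_zero]

/-- A finite admissible sum with the same coordinate along `α ^ 3` exists by greedy expansion, and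
then the difference lies in the lattice. -/
lemma ev_mem_cell (hα : RootBounds α) {x : Vec} (hx : 0 ≤ x.2.2.2) : ∃ g, ev α x ∈ cell α g := by
  have hlt : x.2.2.2 < coeff (x.2.2.2.toNat + 4) := by
    have := lt_coeff x.2.2.2.toNat
    omega
  obtain ⟨δ, hδ, hk, hs⟩ := exists_expansion _ _ hx hlt
  have hv := val_eq_ev hα hk
  set s := ∑ i ∈ Finset.range x.2.2.2.toNat, if δ i then powVec (i + 4) else 0 with hsdef
  have hs' : s.2.2.2 = x.2.2.2 := by
    rw [← hs, hsdef, Prod.snd_sum, Prod.snd_sum, Prod.snd_sum]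
    refine Finset.sum_congr rfl fun i _ => ?_
    split_ifs <;> rfl
  refine ⟨((x - s).1, (x - s).2.1, (x - s).2.2.1), val α δ, ⟨δ, hδ, rfl⟩, ?_⟩
  have e : latticeVec ((x - s).1, (x - s).2.1, (x - s).2.2.1) = x - s := by
    refine Prod.ext rfl (Prod.ext rfl (Prod.ext rfl ?_))
    change 0 = x.2.2.2 - s.2.2.2
    omega
  simp only [e, hv, ev_sub]
  ring

lemma ev_add_mul (α : ℝ × ℂ) (x : Vec) (t : ℤ) (v : Vec) :
    ev α (x + t • v) = ev α x + t * ev α v := by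
  rw [ev_add]
  simp only [ev, Prod.smul_fst, Prod.smul_snd, smul_eq_mul, Int.cast_mul]
  ring

/-- The union of the cells is closed by local finiteness, so approximating `z` suffices. Adding `t *
α ^ (m + 3)` to a nearby `x` is a small change for large `m`, yet raises the `α ^ 3`-coordinate by
at least `t`, enough to make it nonnegative. -/
theorem iUnion_cell (hα : RootBounds α) (z : ℝ × ℂ) : ∃ g, z ∈ cell α g := by
  have hclosed : IsClosed (⋃ g, cell α g) :=
    (locallyFinite_cell hα).isClosed_iUnion (isClosed_cell hα)
  suffices z ∈ closure (⋃ g, cell α g) by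
    rw [hclosed.closure_eq] at this
    exact Set.mem_iUnion.1 this
  rw [Metric.mem_closure_iff]
  intro ε hε
  obtain ⟨x, hx⟩ := exists_norm_sub_ev_lt hα z (half_pos hε)
  have h1 := ((tendsto_pow_mul hα (k := 1) one_ne_zero (|x.2.2.2| : ℤ)).comp
    (Filter.tendsto_add_atTop_nat 3)).norm
  rw [norm_zero] at h1
  obtain ⟨m, hm⟩ := (h1.eventually (gt_mem_nhds (half_pos hε))).exists
  simp only [Function.comp_apply, pow_one] at hm
  set t : ℤ := |x.2.2.2|
  have hc := (coeff_nonneg_and_pos m).2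
  have hnn : 0 ≤ (x + t • powVec (m + 3)).2.2.2 := by
    change 0 ≤ x.2.2.2 + t * coeff (m + 3)
    have h2 : t * 1 ≤ t * coeff (m + 3) := mul_le_mul_of_nonneg_left hc (abs_nonneg _)
    have h3 : -x.2.2.2 ≤ t := neg_le_abs _
    omega
  obtain ⟨g, hg⟩ := ev_mem_cell hα hnn
  refine ⟨_, Set.mem_iUnion.2 ⟨g, hg⟩, ?_⟩
  rw [dist_eq_norm, ev_add_mul, ev_powVec hα, ← sub_sub]
  have h4 := norm_sub_le (z - ev α x) ((t : ℝ × ℂ) * α ^ (m + 3))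
  rw [mul_comm (t : ℝ × ℂ)] at h4 ⊢
  linarith

/-- No infinite path from `y` has only digits `0` in the first sequence. -/
def zeroDead : ℕ → Vec → Bool
  | 0, _ => false
  | n + 1, y => [false, true].all fun q =>
    decide (child y false q ∉ alive) || zeroDead n (child y false q)

lemma zeroDead_alive : ∀ y ∈ alive, zeroDead 8 y = true := by
  decide +kernel

lemma sub_ev_step (hα : RootBounds α) {y : Vec} {p : Bool} {z : ℝ × ℂ}
    (h : digit α p + α * z - ev α y ∈ tile α 0) :
    ∃ q, z - ev α (child y p q) ∈ tile α 0 := by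
  obtain ⟨-, q, w, hw, e⟩ := (mem_tile_iff hα).1 h
  refine ⟨q, ?_⟩
  have : z - ev α (child y p q) = w := mul_left_cancel_pow hα 1 (by
    linear_combination e - mul_ev_child hα y p q)
  rw [this]
  exact tile_anti α (Nat.zero_le _) hw

/-- The expansion of `0` with all digits `0` would give an infinite path in `alive` along which the
first digit is always `0`; there is none. -/
lemma zero_sub_ev_notMem (hα : RootBounds α) {n : ℕ} {y : Vec} (hy : y ∈ alive)
    (h : zeroDead n y = true) : 0 - ev α y ∉ tile α 0 := by
  induction n generalizing y with
  | zero => cases h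
  | succ n ih =>
    intro hz
    rw [zeroDead, List.all_eq_true] at h
    obtain ⟨q, hq⟩ := sub_ev_step hα (p := false) (z := 0) (by simpa [digit] using hz)
    have hc : child y false q ∈ alive := child_mem_alive hα hy (r := 0) (s := 0)
      ⟨zero_mem_tile α (by omega), hq⟩
    have h1 := h q (by cases q <;> simp)
    rw [Bool.or_eq_true, decide_eq_true_eq] at h1
    exact ih hc (h1.resolve_left (not_not.2 hc)) hq

/-- A finite sum is in no other cell. -/
lemma val_sub_ev_notMem (hα : RootBounds α) {k : ℕ} {δ : ℕ → Bool} (hδ : NoFour 0 δ)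
    (hk : ∀ i, k ≤ i → δ i = false) {y : Vec} (hy : y ∈ alive) :
    val α δ - ev α y ∉ tile α 0 := by
  induction k generalizing δ y with
  | zero =>
    have : val α δ = 0 := by simp [val, term, fun i => hk i (Nat.zero_le i)]
    rw [this]
    exact zero_sub_ev_notMem hα hy (zeroDead_alive y hy)
  | succ k ih =>
    intro hz
    rw [val_eq hα] at hz
    obtain ⟨q, hq⟩ := sub_ev_step hα hz
    have hδ' : NoFour 0 fun n => δ (n + 1) := (noFour_iff.1 hδ).2.anti (Nat.zero_le _)
    exact ih hδ' (fun i hi => hk _ (by omega))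
      (child_mem_alive hα hy (r := 0) (s := 0) ⟨⟨_, hδ', rfl⟩, hq⟩) hq

def truncate (n : ℕ) (δ : ℕ → Bool) (i : ℕ) : Bool := if i < n then δ i else false

lemma NoFour.truncate {r : ℕ} {δ : ℕ → Bool} (hδ : NoFour r δ) (n : ℕ) :
    NoFour r (truncate n δ) := by
  have key : ∀ i, δ i = false → Tetranacci.truncate n δ i = false := fun i hi => by
    unfold Tetranacci.truncate
    split_ifs
    · exact hi
    · rfl
  obtain ⟨⟨i, hi, hi'⟩, h⟩ := hδ
  exact ⟨⟨i, hi, key i hi'⟩, fun m => (h m).imp fun j hj => ⟨hj.1, key _ hj.2⟩⟩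

lemma tendsto_val_truncate (hα : RootBounds α) (δ : ℕ → Bool) :
    Filter.Tendsto (fun n => val α (truncate n δ)) Filter.atTop (nhds (val α δ)) := by
  refine ((continuous_val hα).tendsto δ).comp (tendsto_pi_nhds.2 fun i => ?_)
  refine tendsto_const_nhds.congr' ?_
  filter_upwards [Filter.eventually_gt_atTop i] with n hn
  simp [truncate, hn]

/-- Approximate `z - ev α x` by truncations of its expansion. If `z` were interior, some finite sum
translated by `ev α x` would lie in the tile, against `val_sub_ev_notMem`. -/
lemma pair_disjoint_interior (hα : RootBounds α) {x : Vec} (hx : -x ∈ alive) {z : ℝ × ℂ}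
    (hz : z ∈ pair α x 0 0) : z ∉ interior (tile α 0) := by
  intro hi
  obtain ⟨-, δ, hδ, he⟩ := hz
  have h1 := (tendsto_val_truncate hα δ).add_const (ev α x)
  rw [he, sub_add_cancel] at h1
  obtain ⟨n, hn⟩ := (h1.eventually (isOpen_interior.mem_nhds hi)).exists
  refine val_sub_ev_notMem hα (NoFour.truncate hδ n) (k := n) (fun i hi => ?_) hx ?_
  · simp [truncate, not_lt.2 hi]
  · rw [ev_neg, sub_neg_eq_add]
    exact interior_subset hn

lemma shiftVecs_subset : ∀ x ∈ halfVecs ∪ halfVecs.image (-·), -x ∈ alive := by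
  decide +kernel

lemma alive_subset : ∀ x ∈ alive, x.2.2.2 = 0 → x ∈ halfVecs ∪ halfVecs.image (-·) := by
  decide +kernel

theorem frontier_fractal (hα : RootBounds α) :
    frontier (fractal α) = ⋃ u ∈ shifts α, region α u := by
  have hcl : IsClosed (tile α 0) := (isCompact_tile hα 0).isClosed
  rw [fractal_eq_tile hα, hcl.frontier_eq, shifts_eq hα]
  ext z
  rw [Set.biUnion_image]
  simp only [Set.mem_iUnion, region_ev hα]
  constructor
  · rintro ⟨hz, hint⟩
    obtain ⟨g, hg, hzg⟩ : ∃ g : ℤ × ℤ × ℤ, g ≠ 0 ∧ z ∈ cell α g := by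
      by_contra! hcon
      -- If `z` is in no other cell, the complement of the union of the others is an open
      -- neighbourhood of `z`, contained in the tile because the cells cover everything.
      have hclosed : IsClosed (⋃ g : {g : ℤ × ℤ × ℤ // g ≠ 0}, cell α g) :=
        ((locallyFinite_cell hα).comp_injective Subtype.val_injective).isClosed_iUnion
          fun g => isClosed_cell hα g
      refine hint (mem_interior.2 ⟨_, fun w hw => ?_, hclosed.isOpen_compl, fun h => ?_⟩)
      · obtain ⟨g, hg⟩ := iUnion_cell hα w
        by_cases h0 : g = 0
        · subst h0
          obtain ⟨w', hw', rfl⟩ := hg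
          have : ev α (latticeVec 0) = 0 := ev_zero α
          simpa [this] using hw'
        · exact absurd (Set.mem_iUnion.2 ⟨⟨g, h0⟩, hg⟩) hw
      · obtain ⟨⟨g, h0⟩, hg⟩ := Set.mem_iUnion.1 h
        exact hcon g h0 hg
    have hp : z ∈ pair α (latticeVec g) 0 0 := by
      obtain ⟨w, hw, rfl⟩ := hzg
      exact ⟨hz, by simpa using hw⟩
    have h0 : latticeVec g ≠ 0 := fun h => hg (by
      simp only [latticeVec, Prod.ext_iff, Prod.fst_zero, Prod.snd_zero] at h
      exact Prod.ext h.1 (Prod.ext h.2.1 h.2.2.1))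
    exact ⟨_, alive_subset _ (mem_alive_of_mem_pair hα hp h0) rfl, hp⟩
  · rintro ⟨x, hx, hz⟩
    exact ⟨hz.1, pair_disjoint_interior hα (shiftVecs_subset x hx) hz⟩

end Frontier
end Tetranacci
end

theorem mainTheorem4 (β₂ : ℝ) (β₃ : ℂ) (hβ₂ : Tetranacci.IsRealRoot β₂)
    (hβ₃ : Tetranacci.IsComplexRoot β₃) (α : ℝ × ℂ) (hα : α = (β₂, β₃)) :
    -- the regions which are explicit affine images of `X`
    Tetranacci.region α 1 = (fun z => 1 + α * z) '' Tetranacci.X α ∧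
    Tetranacci.region α (α ^ 2) = (fun z => -(1 / α) - 1 - α + z / α) '' Tetranacci.X α ∧
    -- the singletons
    Tetranacci.region α (1 + α ^ 2) = {α ^ 4 / (1 - α ^ 2)} ∧
    Tetranacci.region α (α ^ (-2 : ℤ) + α ^ (-1 : ℤ) + α) = {(α ^ 5 + α ^ 6) / (1 - α ^ 4)} ∧
    Tetranacci.region α (α ^ (-3 : ℤ) + α ^ (-2 : ℤ) + 1 + α ^ 3) =
      {(α ^ 4 + α ^ 5) / (1 - α ^ 4)} ∧
    -- the regions which are explicit unions of affine images of `X` and `Y`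
    Tetranacci.region α α =
      Tetranacci.f α 0 '' Tetranacci.X α ∪ Tetranacci.f α 1 '' Tetranacci.X α ∪
        Tetranacci.f α 1 '' Tetranacci.Y α ∧
    Tetranacci.region α (α + α ^ 2) =
      Tetranacci.g α 0 '' Tetranacci.X α ∪ Tetranacci.g α 1 '' Tetranacci.X α ∪
        Tetranacci.g α 1 '' Tetranacci.Y α ∪ Tetranacci.g α 2 '' Tetranacci.Y α ∪
        Tetranacci.g α 3 '' Tetranacci.Y α ∧
    -- the graph-directed system for `X` and `Y`
    Tetranacci.X α =
      (⋃ i ∈ Set.Icc (0 : Fin 18) 4, Tetranacci.h α i '' Tetranacci.X α) ∪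
        Tetranacci.h α 1 '' Tetranacci.Y α ∪ Tetranacci.h α 3 '' Tetranacci.Y α ∧
    Tetranacci.Y α =
      (⋃ i ∈ Set.Icc (5 : Fin 18) 11, Tetranacci.h α i '' Tetranacci.Y α) ∪
        (⋃ i ∈ Set.Icc (12 : Fin 18) 17, Tetranacci.h α i '' Tetranacci.X α) ∧
    -- the regions of opposite index are translates of each other
    (∀ u : ℝ × ℂ, Tetranacci.region α (-u) = (fun z => z - u) '' Tetranacci.region α u) ∧
    -- there are 18 nonempty regions, exactly six of which are singletons
    (Tetranacci.shifts α).ncard = 18 ∧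
    (∀ u ∈ Tetranacci.shifts α, (Tetranacci.region α u).Nonempty) ∧
    {u ∈ Tetranacci.shifts α | ∃ z, Tetranacci.region α u = {z}} = Tetranacci.pointShifts α ∧
    (Tetranacci.pointShifts α).ncard = 6 ∧
    -- `X` and `Y` are compact, and the boundary is the union of the 18 regions
    IsCompact (Tetranacci.X α) ∧ IsCompact (Tetranacci.Y α) ∧
    frontier (Tetranacci.fractal α) = ⋃ u ∈ Tetranacci.shifts α, Tetranacci.region α u := by
  subst hα
  have hα := Tetranacci.rootBounds hβ₂ hβ₃
  open Tetranacci in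
  exact ⟨region_one hα, region_sq hα, region_one_add_sq hα, region_sq_sub_one hα,
    region_one_two_one hα, region_alpha hα, region_alpha_add_sq hα, X_decomposition hα,
    Y_decomposition hα, region_neg _, ncard_shifts hα, region_nonempty hα, singleton_shifts hα,
    ncard_pointShifts hα, isCompact_region hα _, isCompact_region hα _, frontier_fractal hα⟩
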